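/- **Theorem (second-order iteration complexity of Newton-MR with inexact Hessian).** Let $f:\mathbb R^d\to\mathbb R$ ($d\ge 1$) be twice continuously differentiable with gradient $\mathbf g$ and Hessian $\mathbf H$, let $\|\mathbf H(\mathbf x)\|\le L_{\mathbf g}$ and $\|\mathbf H(\mathbf x)-\mathbf H(\mathbf y)\|\le L_{\mathbf H}\|\mathbf x-\mathbf y\|$ for all $\mathbf x,\mathbf y$, with $0\le L_{\mathbf g}<\infty$ and $0<L_{\mathbf H}<\infty$ (Euclidean and spectral norms), and let $f^\star=\min f$ exist. Let $\bar{\mathbf H}(\mathbf x)=\mathbf H(\mathbf x)+\mathbf E(\mathbf x)$, where $\mathbf E(\mathbf x)$ is symmetric, measurable in $\mathbf x$, and $\|\mathbf E(\mathbf x)\|\le\varepsilon$ for some $\varepsilon>0$. Let $0<\varepsilon_{\mathbf g},\varepsilon_{\mathbf H}\le 1$, $0<\rho_S<\tfrac12$, $0<\rho_N<1$, $\theta>0$, $\eta=\theta\sqrt{\varepsilon_{\mathbf g}}$. *MINRES.* For symmetric $\mathbf A$ and $\mathbf b\neq \mathbf 0$, $\mathrm{MINRES}(\mathbf A,\mathbf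 b,\eta)$ generates by the Lanczos process from $-\mathbf b$ an orthonormal basis $\mathbf V_t=[\mathbf v_1,\dots,\mathbf v_t]$ of the Krylov space $\mathcal K_t(\mathbf A,\mathbf b)$ and, by the usual short recurrences with plane rotations, the iterates $\mathbf s_t=\arg\min_{\mathbf s\in\mathcal K_t(\mathbf A,\mathbf b)}\|\mathbf A\mathbf s+\mathbf b\|$ (with $\mathbf s_0=\mathbf 0$) and the residuals $\mathbf r_t=-\mathbf A\mathbf s_t-\mathbf b$. In iteration $t=1,2,\dots$ it first tests $\|\mathbf A\mathbf r_{t-1}\|\le\eta\|\mathbf A\mathbf s_{t-1}\|$ and, if this holds, returns $\mathbf s_{t-1}$ with Type $=$ SOL; otherwise it tests $\langle\mathbf r_{t-1},\mathbf A\mathbf r_{t-1}\rangle\le 0$ and, if this holds, returns $\mathbf r_{t-1}$ with Type $=$ NPC. Both tests are made on the scalars of the recurrences. Put $\mathbf T_t=\mathbf V_t^\top\mathbf A\mathbf V_t$. *Algorithm.* Start at $\mathbf x_0$. At $\mathbf x_k$, write $\mathbf g_k=\mathbf g(\mathbf x_k)$, $\bar{\mathbf H}_k=\bar{\mathbf H}(\mathbf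 x_k)$. - If $\|\mathbf g_k\|>\varepsilon_{\mathbf g}$, let $(\mathbf d_k,\text{Type})=\mathrm{MINRES}(\bar{\mathbf H}_k,\mathbf g_k,\eta)$. If Type $=$ SOL, let $\alpha_k$ be the largest $\alpha\in(0,1]$ with $f(\mathbf x_k+\alpha\mathbf d_k)\le f(\mathbf x_k)+\rho_S\,\alpha\langle\mathbf g_k,\mathbf d_k\rangle$; if Type $=$ NPC, let $\alpha_k$ be the largest $\alpha\in(0,\infty)$ with $f(\mathbf x_k+\alpha\mathbf d_k)\le f(\mathbf x_k)+\rho_N\,\alpha\langle\mathbf g_k,\mathbf d_k\rangle$. - If $\|\mathbf g_k\|\le\varepsilon_{\mathbf g}$, draw $\tilde{\mathbf g}_k$ from the uniform distribution on the unit sphere, independently of all other draws, and call $\mathrm{MINRES}\big(\bar{\mathbf H}_k+\tfrac12(\varepsilon_{\mathbf H}-\varepsilon)\mathbf I,\ \tilde{\mathbf g}_k,\ 0\big)$. If Type $=$ SOL, terminate and return $\mathbf x_k$. If Type $=$ NPC with vector $\mathbf r$, let $\mathbf d_k=-\mathrm{Sign}(\langle\mathbf g_k,\mathbf r\rangle)\,\mathbf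 r/\|\mathbf r\|$ (with $\mathrm{Sign}(0)$ chosen as $1$ or $-1$, arbitrarily for each $k$) and let $\alpha_k$ be the largest $\alpha\in(0,\infty)$ with $f(\mathbf x_k+\alpha\mathbf d_k)\le f(\mathbf x_k)+\tfrac12\rho_N\,\alpha^2\langle\mathbf d_k,\bar{\mathbf H}_k\mathbf d_k\rangle$. Unless terminated, set $\mathbf x_{k+1}=\mathbf x_k+\alpha_k\mathbf d_k$ and continue. *Assumptions.* (i) There is $\sigma>0$ such that for every $\mathbf x\in\mathbb R^d$, in $\mathrm{MINRES}(\bar{\mathbf H}(\mathbf x),\mathbf g(\mathbf x),\eta)$ one has $\mathbf T_t\succeq\sigma\mathbf I$ for each iteration $t$ that is performed, as long as Type $=$ NPC has not been returned in one of the iterations $1,\dots,t$ (and as long as the Krylov space is not exhausted, i.e. $\mathbf v_t$ exists). (ii) There is $\omega>0$ such that, almost surely, whenever the first MINRES call at an iterate $\mathbf x_k$ of the algorithm (with $\|\mathbf g_k\|>\varepsilon_{\mathbf g}$) returns an NPC direction $\mathbf r$, one has $\|\mathbf r\|\ge\omega\|\mathbf g_k\|$. (iii) $$\varepsilon\le\min\Big\{\frac{\sqrt{\varepsilon_{\mathbf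 g}}}{\eta+\sigma},\ \frac{\sigma(1-2\rho_S)}2,\ 1-\rho_N,\ \frac{\varepsilon_{\mathbf H}}{10},\ \frac{(1-\rho_N)\varepsilon_{\mathbf H}}{2(3-\rho_N)}\Big\}.$$ *Constants.* Let $$c_0=\frac{2\sigma}{(1+\theta L_{\mathbf g})+\sqrt{(1+\theta L_{\mathbf g})^2+2\sigma^2L_{\mathbf H}}},\qquad c_1=\rho_S\sigma\Big(\frac{3(1-2\rho_S)\sigma}{2L_{\mathbf H}}\Big)^2,\qquad c_2=\rho_S\sigma c_0^2,$$ $$c_3=\rho_N\min\Big\{\omega^{3/2}\sqrt{\frac{3(1-\rho_N)}{L_{\mathbf H}}},\ (1-\rho_N)\,\sigma\,\omega^2\Big\},\qquad c_4=\frac{9\rho_N(1-\rho_N)^2}{8(4L_{\mathbf H})^2}.$$ *Conclusion.* With probability one, the algorithm is well defined and terminates at an iterate $\mathbf x_k$ with $$k\le\Big\lceil\frac{2(f(\mathbf x_0)-f^\star)}{\min\{2c_1,2c_2,2c_3,c_4\}}\max\{\varepsilon_{\mathbf g}^{-3/2},\varepsilon_{\mathbf H}^{-3}\}+1\Big\rceil,$$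 and $\mathbf x_k$ is $(\varepsilon_{\mathbf g},\varepsilon_{\mathbf H})$-optimal: $\|\mathbf g(\mathbf x_k)\|\le\varepsilon_{\mathbf g}$ and $\lambda_{\min}(\mathbf H(\mathbf x_k))\ge-\varepsilon_{\mathbf H}$. -/

import Mathlib

open MeasureTheory ProbabilityTheory

namespace NewtonMR

/-- The Euclidean space `ℝ^d`. -/
abbrev Vec (d : ℕ) := EuclideanSpace ℝ (Fin d)

/-- The Hessian of `f` at `x`, as a linear operator: the derivative of the gradient. Its operator
norm is the spectral norm of the Hessian matrix. -/
noncomputable def hessian {d : ℕ} (f : Vec d → ℝ) (x : Vec d) : Vec d →L[ℝ] Vec d :=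
  fderiv ℝ (gradient f) x

/-- `(εg, εH)`-optimality: `‖∇f(x)‖ ≤ εg` and the smallest (hence every) eigenvalue of the Hessian
at `x` is at least `-εH`. -/
def IsSecondOrderOptimal {d : ℕ} (f : Vec d → ℝ) (εg εH : ℝ) (x : Vec d) : Prop :=
  ‖gradient f x‖ ≤ εg ∧
    ∀ μ : ℝ, Module.End.HasEigenvalue (hessian f x : Vec d →ₗ[ℝ] Vec d) μ → -εH ≤ μ

/-! ### MINRES -/

/-- The two kinds of directions that MINRES returns. -/
inductive DirType where
  | SOL
  | NPC

/-- The values of the MINRES variables on entering iteration `t ≥ 1`. -/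
structure MinresState (d : ℕ) where
  /-- the Lanczos vector `v_t` -/
  v : Vec d
  /-- `v_{t-1}` -/
  vPrev : Vec d
  /-- `w_{t-1}` -/
  w : Vec d
  /-- `w_{t-2}` -/
  wPrev : Vec d
  /-- the iterate `s_{t-1}` -/
  s : Vec d
  /-- the residual `r_{t-1}` -/
  r : Vec d
  /-- `β_t` -/
  β : ℝ
  /-- the cosine `c_{t-1}` -/
  c : ℝ
  /-- the sine `s_{t-1}` -/
  sn : ℝ
  /-- `φ_{t-1}` -/
  φ : ℝ
  /-- `δ_t^{(1)}` -/
  δ₁ : ℝ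
  /-- `ε_t` -/
  ϵ : ℝ

namespace MinresState

variable {d : ℕ}

/-- Initialisation of MINRES for `min ‖A s + g‖`. -/
noncomputable def init (g : Vec d) : MinresState d where
  v := ‖g‖⁻¹ • (-g)
  vPrev := 0
  w := 0
  wPrev := 0
  s := 0
  r := -g
  β := ‖g‖
  c := -1
  sn := 0
  φ := ‖g‖
  δ₁ := 0
  ϵ := 0

/-- `α_t = ⟨v_t, A v_t⟩`. -/
noncomputable def α (A : Vec d →L[ℝ] Vec d) (S : MinresState d) : ℝ := inner ℝ S.v (A S.v)

/-- `q_t = A v_t - β_t v_{t-1} - α_t v_t`. -/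
noncomputable def q (A : Vec d →L[ℝ] Vec d) (S : MinresState d) : Vec d :=
  A S.v - S.β • S.vPrev - S.α A • S.v

/-- `β_{t+1} = ‖q_t‖`. -/
noncomputable def βNext (A : Vec d →L[ℝ] Vec d) (S : MinresState d) : ℝ := ‖S.q A‖

/-- `δ_t^{(2)} = c_{t-1} δ_t^{(1)} + s_{t-1} α_t`. -/
noncomputable def δ₂ (A : Vec d →L[ℝ] Vec d) (S : MinresState d) : ℝ :=
  S.c * S.δ₁ + S.sn * S.α A

/-- `ε_{t+1} = s_{t-1} β_{t+1}`. -/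
noncomputable def ϵNext (A : Vec d →L[ℝ] Vec d) (S : MinresState d) : ℝ := S.sn * S.βNext A

/-- `γ_t^{(1)} = s_{t-1} δ_t^{(1)} - c_{t-1} α_t`. -/
noncomputable def γ₁ (A : Vec d →L[ℝ] Vec d) (S : MinresState d) : ℝ :=
  S.sn * S.δ₁ - S.c * S.α A

/-- `δ_{t+1}^{(1)} = -c_{t-1} β_{t+1}`. -/
noncomputable def δNext (A : Vec d →L[ℝ] Vec d) (S : MinresState d) : ℝ := -S.c * S.βNext A

/-- `γ_t^{(2)}`. -/
noncomputable def γ₂ (A : Vec d →L[ℝ] Vec d) (S : MinresState d) : ℝ :=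
  Real.sqrt (S.γ₁ A ^ 2 + S.βNext A ^ 2)

open Classical in
/-- The remaining updates of iteration `t`. If `β_{t+1} = 0` (the Krylov space is exhausted) then
`φ_t = 0`, the residual is zero and iteration `t + 1` returns `s_t`; the variables `v_{t+1}` and
`r_t` are then set to zero. The case `γ_t^{(2)} = 0` is never reached by a run of MINRES, because
the curvature test succeeds before. -/
noncomputable def next (A : Vec d →L[ℝ] Vec d) (S : MinresState d) : MinresState d :=
  if S.γ₂ A ≠ 0 then
    let c' := S.γ₁ A / S.γ₂ A
    let sn' := S.βNext A / S.γ₂ A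
    let τ := c' * S.φ
    let φ' := sn' * S.φ
    let w' := (S.γ₂ A)⁻¹ • (S.v - S.δ₂ A • S.w - S.ϵ • S.wPrev)
    let v' : Vec d := if S.βNext A ≠ 0 then (S.βNext A)⁻¹ • S.q A else 0
    { v := v'
      vPrev := S.v
      w := w'
      wPrev := S.w
      s := S.s + τ • w'
      r := if S.βNext A ≠ 0 then sn' ^ 2 • S.r - (φ' * c') • v' else 0
      β := S.βNext A
      c := c'
      sn := sn'
      φ := φ'
      δ₁ := S.δNext A
      ϵ := S.ϵNext A }
  else
    { v := 0
      vPrev := S.v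
      w := 0
      wPrev := S.w
      s := S.s
      r := S.r
      β := S.βNext A
      c := 0
      sn := 1
      φ := S.φ
      δ₁ := S.δNext A
      ϵ := S.ϵNext A }

end MinresState

section Minres

variable {d : ℕ}

/-- The MINRES variables on entering iteration `j + 1`. -/
noncomputable def minresState (A : Vec d →L[ℝ] Vec d) (g : Vec d) : ℕ → MinresState d
  | 0 => MinresState.init g
  | j + 1 => (minresState A g j).next A

/-- The inexactness test of iteration `t = j + 1`:
`φ_{t-1} √((γ_t^{(1)})² + (δ_{t+1}^{(1)})²) ≤ η √(φ_0² - φ_{t-1}²)`. -/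
def minresSolTest (A : Vec d →L[ℝ] Vec d) (g : Vec d) (η : ℝ) (j : ℕ) : Prop :=
  let S := minresState A g j
  S.φ * Real.sqrt (S.γ₁ A ^ 2 + S.δNext A ^ 2) ≤ η * Real.sqrt (‖g‖ ^ 2 - S.φ ^ 2)

/-- The nonpositive curvature test of iteration `t = j + 1`: `c_{t-1} γ_t^{(1)} ≥ 0`. -/
def minresNpcTest (A : Vec d →L[ℝ] Vec d) (g : Vec d) (j : ℕ) : Prop :=
  let S := minresState A g j
  0 ≤ S.c * S.γ₁ A

open Classical in
/-- The value returned by `MINRES(A, g, η)`: at the first iteration where one of the two tests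
succeeds, `(s_{t-1}, SOL)` if the inexactness test (which is made first) succeeds, and
`(r_{t-1}, NPC)` otherwise; `none` if the loop never ends. -/
noncomputable def minres (A : Vec d →L[ℝ] Vec d) (g : Vec d) (η : ℝ) :
    Option (Vec d × DirType) :=
  if h : ∃ j, minresSolTest A g η j ∨ minresNpcTest A g j then
    if minresSolTest A g η (Nat.find h) then
      some ((minresState A g (Nat.find h)).s, DirType.SOL)
    else
      some ((minresState A g (Nat.find h)).r, DirType.NPC)
  else none

/-- `MINRES(A, g, η)` performs iteration `t = j + 1` and does not detect a nonpositive curvature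
direction during iterations `1, …, t`. -/
def minresNpcNotDetected (A : Vec d →L[ℝ] Vec d) (g : Vec d) (η : ℝ) (j : ℕ) : Prop :=
  (∀ i < j, ¬ minresSolTest A g η i ∧ ¬ minresNpcTest A g i) ∧
    (minresSolTest A g η j ∨ ¬ minresNpcTest A g j)

/-- The matrix `T_t = V_tᵀ A V_t` with `V_t = [v_1, …, v_t]`. -/
noncomputable def lanczosMatrix (A : Vec d →L[ℝ] Vec d) (g : Vec d) (t : ℕ) :
    Matrix (Fin t) (Fin t) ℝ :=
  Matrix.of fun i j => inner ℝ (minresState A g i).v (A (minresState A g j).v)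

end Minres

/-- Krylov subspace regularity with constant `σ`: for every `x`, as long as MINRES applied to
`H̄(x)` and `∇f(x)` has not detected a nonpositive curvature direction, `T_t ⪰ σ I`. Here `T_t` is
formed only while the Krylov space is not exhausted, i.e. while there is a Lanczos vector
`v_t ≠ 0`. -/
def KrylovRegular {d : ℕ} (f : Vec d → ℝ) (Hbar : Vec d → Vec d →L[ℝ] Vec d) (η σ : ℝ) : Prop :=
  ∀ (x : Vec d) (j : ℕ), minresNpcNotDetected (Hbar x) (gradient f x) η j →
    (minresState (Hbar x) (gradient f x) j).v ≠ 0 →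
    (lanczosMatrix (Hbar x) (gradient f x) (j + 1)
      - σ • (1 : Matrix (Fin (j + 1)) (Fin (j + 1)) ℝ)).PosSemidef

/-! ### The outer algorithm -/

/-- The objective, the inexact Hessian, and the parameters of the algorithm. -/
structure Problem (d : ℕ) where
  /-- objective -/
  f : Vec d → ℝ
  /-- inexact Hessian -/
  Hbar : Vec d → Vec d →L[ℝ] Vec d
  /-- first-order tolerance -/
  εg : ℝ
  /-- second-order tolerance -/
  εH : ℝ
  /-- bound on the Hessian noise -/
  ε : ℝ
  /-- inexactness tolerance of MINRES -/
  η : ℝ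
  /-- line-search parameter for directions of type SOL -/
  ρS : ℝ
  /-- line-search parameter for directions of type NPC -/
  ρN : ℝ

/-- The result of one pass through the main loop. -/
inductive Outcome (d : ℕ) where
  /-- the next iterate has been computed -/
  | moved (x : Vec d)
  /-- the algorithm stops and returns the current iterate -/
  | terminated
  /-- MINRES does not return, or no step size exists -/
  | stuck

open Classical in
/-- The move `x + α p`, where `α` is the greatest element of the set `S` of acceptable step
sizes. -/
noncomputable def lineSearchStep {d : ℕ} (x p : Vec d) (S : Set ℝ) : Outcome d :=
  if h : ∃ α, IsGreatest S α then Outcome.moved (x + Classical.choose h • p) else Outcome.stuck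

open Classical in
/-- The sign of `a`, with the value `ς` at `a = 0`. -/
noncomputable def signWith (ς a : ℝ) : ℝ := if a = 0 then ς else if 0 < a then 1 else -1

namespace Problem

variable {d : ℕ}

/-- The normalised direction of nonpositive curvature `-Sign(⟨∇f(x), r⟩) r / ‖r‖`. -/
noncomputable def npcDirection (p : Problem d) (ς : ℝ) (x r : Vec d) : Vec d :=
  (-signWith ς (inner ℝ (gradient p.f x) r) * ‖r‖⁻¹) • r

/-- The step sizes acceptable for the Armijo condition
`f(x + α e) ≤ f(x) + ρ α ⟨∇f(x), e⟩`. -/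
def armijo (p : Problem d) (ρ : ℝ) (x e : Vec d) : Set ℝ :=
  {α | 0 < α ∧ p.f (x + α • e) ≤ p.f x + ρ * α * inner ℝ (gradient p.f x) e}

/-- The step sizes acceptable for the curvature condition
`f(x + α e) ≤ f(x) + ½ ρ_N α² ⟨e, H̄(x) e⟩`. -/
def curvatureArmijo (p : Problem d) (x e : Vec d) : Set ℝ :=
  {α | 0 < α ∧ p.f (x + α • e) ≤ p.f x + 1 / 2 * p.ρN * α ^ 2 * inner ℝ e (p.Hbar x e)}

open Classical in
/-- One pass through the main loop at the point `x`; `u` is the random unit vector drawn if the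
gradient is small, `ς` the value used for `Sign(0)`. -/
noncomputable def step (p : Problem d) (ς : ℝ) (u x : Vec d) : Outcome d :=
  if p.εg < ‖gradient p.f x‖ then
    match minres (p.Hbar x) (gradient p.f x) p.η with
    | some (e, DirType.SOL) => lineSearchStep x e (p.armijo p.ρS x e ∩ Set.Iic 1)
    | some (e, DirType.NPC) => lineSearchStep x e (p.armijo p.ρN x e)
    | none => Outcome.stuck
  else
    match minres (p.Hbar x + (1 / 2 * (p.εH - p.ε)) • ContinuousLinearMap.id ℝ (Vec d)) u 0 with
    | some (_, DirType.SOL) => Outcome.terminated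
    | some (r, DirType.NPC) =>
        lineSearchStep x (p.npcDirection ς x r) (p.curvatureArmijo x (p.npcDirection ς x r))
    | none => Outcome.stuck

/-- The iterate `x_k` of the run started at `x₀` in which the vector `u k` is drawn and the value
`ς k` is used for `Sign(0)` in iteration `k`; `none` if the run has ended before. -/
noncomputable def iterate (p : Problem d) (x₀ : Vec d) (ς : ℕ → ℝ) (u : ℕ → Vec d) :
    ℕ → Option (Vec d)
  | 0 => some x₀
  | k + 1 =>
    match p.iterate x₀ ς u k with
    | some x =>
      match p.step (ς k) (u k) x with
      | Outcome.moved y => some y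
      | Outcome.terminated => none
      | Outcome.stuck => none
    | none => none

end Problem

/-- The uniform probability distribution on the unit sphere of `ℝ^d`. -/
noncomputable def uniformSphere (d : ℕ) : Measure (Metric.sphere (0 : Vec d) 1) :=
  ((volume : Measure (Vec d)).toSphere Set.univ)⁻¹ • (volume : Measure (Vec d)).toSphere

/-! ### The constants -/

noncomputable def c₀ (σ θ Lg LH : ℝ) : ℝ :=
  2 * σ / ((1 + θ * Lg) + Real.sqrt ((1 + θ * Lg) ^ 2 + 2 * σ ^ 2 * LH))

noncomputable def c₁ (σ ρS LH : ℝ) : ℝ := ρS * σ * (3 * (1 - 2 * ρS) * σ / (2 * LH)) ^ 2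

noncomputable def c₂ (σ ρS θ Lg LH : ℝ) : ℝ := ρS * σ * c₀ σ θ Lg LH ^ 2

noncomputable def c₃ (σ ρN ω LH : ℝ) : ℝ :=
  ρN * min (ω ^ (3 / 2 : ℝ) * Real.sqrt (3 * (1 - ρN) / LH)) ((1 - ρN) * σ * ω ^ 2)

noncomputable def c₄ (ρN LH : ℝ) : ℝ := 9 * ρN * (1 - ρN) ^ 2 / (8 * (4 * LH) ^ 2)

end NewtonMR

/-! Termination is amortised counting in `f`. With D = `p.decrease`, a curvature step at a small
gradient lowers `f` by at least D, and a step at a large gradient by at least D/2. The one exception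
is a full SOL step that lands at a small gradient. The pass after it either stops or gains D, which
pays for both steps. Since `f` is bounded below by `fstar`, the number of steps is bounded
(`iterate_decrease`, `exists_terminated`).

The decrease comes from what MINRES returns. `MinresInv` carries the orthogonality relations through
the short recurrences; it identifies the two scalar tests with ‖Ar‖ ≤ η‖As‖ and ⟨r, Ar⟩ ≤ 0. Since r
⟂ A K, an NPC direction satisfies ⟨g, r⟩ = -‖r‖². For a SOL direction, `ResidualCone` gives ⟨s, r⟩ ≥
0, that is ⟨g, s⟩ ≤ -⟨s, As⟩, and Krylov regularity bounds ⟨s, As⟩ and ⟨r, Ar⟩ from below. Inserted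
in the cubic upper bound `le_inexact_taylor`, these facts yield an acceptable step size of explicit
length. A full SOL step is handled by `c₀_mul_sqrt_le_norm`: if the next gradient is large, the step
was long.

Optimality is the probabilistic half. With η = 0, a SOL answer means that the starting vector lies
in an A-invariant subspace on which A ≥ 0, hence is orthogonal to every eigenvector with negative
eigenvalue (`MinresStopSol.inner_eigenvector`). If the shifted Hessian has negative curvature, the
drawn vector thus lies in a hyperplane that depends only on the iterate, a null set of the sphere.
The iterate is a measurable function of the earlier draws, so it is independent of the present one,
and Fubini makes a wrong stop a null event (`ae_notMem_missed`). The measurability part serves only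
this argument. -/

namespace NewtonMR

/-! ### Invariants of the MINRES recurrences -/

section MinresTheory

variable {d : ℕ}

/-- The normalised residual `r / φ`. -/
noncomputable def MinresState.y (S : MinresState d) : Vec d := S.φ⁻¹ • S.r

/-- On the orthogonal complement of `A K`, the functional `⟨x, ·⟩` is a nonnegative multiple of
`⟨-g, ·⟩`. The iterates of MINRES have this property before nonpositive curvature is detected,
because they are nonnegative combinations of the preceding residuals. -/
def ResidualCone (A : Vec d →L[ℝ] Vec d) (g : Vec d) (K : Submodule ℝ (Vec d)) (x : Vec d) : Prop :=
  ∃ m : ℝ, 0 ≤ m ∧ ∀ z : Vec d, (∀ k ∈ K, inner ℝ z (A k) = 0) → inner ℝ x z = m * inner ℝ (-g) z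

namespace ResidualCone

variable {A : Vec d →L[ℝ] Vec d} {g x x' : Vec d} {K K' : Submodule ℝ (Vec d)}

lemma zero : ResidualCone A g K 0 := ⟨0, le_rfl, by simp⟩

lemma mono (h : ResidualCone A g K x) (hK : K ≤ K') : ResidualCone A g K' x := by
  obtain ⟨m, hm, h⟩ := h
  exact ⟨m, hm, fun z hz => h z fun k hk => hz k (hK hk)⟩

lemma add (h : ResidualCone A g K x) (h' : ResidualCone A g K x') :
    ResidualCone A g K (x + x') := by
  obtain ⟨m, hm, h⟩ := h
  obtain ⟨m', hm', h'⟩ := h'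
  exact ⟨m + m', by positivity, fun z hz => by rw [inner_add_left, h z hz, h' z hz]; ring⟩

lemma smul (h : ResidualCone A g K x) {a : ℝ} (ha : 0 ≤ a) : ResidualCone A g K (a • x) := by
  obtain ⟨m, hm, h⟩ := h
  exact ⟨a * m, by positivity, fun z hz => by
    rw [real_inner_smul_left, h z hz]; ring⟩

/-- Any z orthogonal to A K does not see the term A s, so the multiplier is 1. -/
lemma residual {s : Vec d} (hs : s ∈ K) : ResidualCone A g K (-A s - g) := by
  refine ⟨1, zero_le_one, fun z hz => ?_⟩
  rw [sub_eq_add_neg, inner_add_left, inner_neg_left, real_inner_comm, hz s hs]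
  ring

end ResidualCone

/-- The invariants of MINRES on entering an iteration with a nonzero Lanczos vector; `K` is the
span of the preceding Lanczos vectors. -/
structure MinresInv (A : Vec d →L[ℝ] Vec d) (g : Vec d) (K : Submodule ℝ (Vec d))
    (S : MinresState d) : Prop where
  norm_v : ‖S.v‖ = 1
  v_orth : ∀ x ∈ K, inner ℝ S.v x = 0
  vPrev_mem : S.vPrev ∈ K
  map_mem : ∀ x ∈ K, A x ∈ K ⊔ Submodule.span ℝ {S.v}
  q_orth : ∀ x ∈ K ⊔ Submodule.span ℝ {S.v}, inner ℝ (S.q A) x = 0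
  φ_pos : 0 < S.φ
  norm_y : ‖S.y‖ = 1
  sn_nonneg : 0 ≤ S.sn
  c_sq_add : S.c ^ 2 + S.sn ^ 2 = 1
  c_ne : S.c ≠ 0
  v_eq : S.v = S.sn • A S.w - S.c • S.y
  prev_eq : S.β • S.vPrev = S.δ₁ • (S.c • A S.w + S.sn • S.y) + S.ϵ • A S.wPrev
  map_y : A S.y = S.γ₁ A • S.v - S.c • S.q A
  y_eq : S.y = (S.γ₁ A * S.sn) • S.w - S.c • (S.v - S.δ₂ A • S.w - S.ϵ • S.wPrev)
  yPrev_mem : S.c • A S.w + S.sn • S.y ∈ K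
  w_mem : S.w ∈ K
  wPrev_mem : S.wPrev ∈ K
  s_mem : S.s ∈ K
  y_orth : ∀ x ∈ K, inner ℝ S.y (A x) = 0
  res : S.r = -A S.s - g
  cone_s : ResidualCone A g K S.s
  cone_w : ResidualCone A g K (S.c • S.w)
  psd : ∀ x ∈ K, 0 ≤ inner ℝ x (A x)
  g_mem : g ∈ K ⊔ Submodule.span ℝ {S.v}

variable {A : Vec d →L[ℝ] Vec d} {g : Vec d} {K : Submodule ℝ (Vec d)} {S : MinresState d}

lemma MinresState.map_v (A : Vec d →L[ℝ] Vec d) (S : MinresState d) :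
    A S.v = S.β • S.vPrev + S.α A • S.v + S.q A := by
  rw [MinresState.q]; module

/-- With K = ⊥, c = -1 and sn = 0 the normalised residual is v itself, and the rotation identities
become trivial. -/
lemma MinresInv.init (hg : g ≠ 0) : MinresInv A g ⊥ (MinresState.init g) := by
  have hn : ‖g‖ ≠ 0 := norm_ne_zero_iff.2 hg
  have hv : ‖(MinresState.init g).v‖ = 1 := by
    simp [MinresState.init, norm_smul, hn]
  have hy : (MinresState.init g).y = (MinresState.init g).v := rfl
  have hq : (MinresState.init g).q A = A (MinresState.init g).v
      - (MinresState.init g).α A • (MinresState.init g).v := by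
    simp [MinresState.q, MinresState.init]
  refine
    { norm_v := hv
      v_orth := by simp
      vPrev_mem := by simp [MinresState.init]
      map_mem := by simp
      q_orth := ?_
      φ_pos := by simpa [MinresState.init] using hg
      norm_y := hv
      sn_nonneg := le_rfl
      c_sq_add := by simp [MinresState.init]
      c_ne := by simp [MinresState.init]
      v_eq := by rw [hy]; simp [MinresState.init]
      prev_eq := by simp [MinresState.init]
      map_y := ?_
      y_eq := by rw [hy]; simp [MinresState.init]
      yPrev_mem := by simp [MinresState.init]
      w_mem := by simp [MinresState.init]
      wPrev_mem := by simp [MinresState.init]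
      s_mem := by simp [MinresState.init]
      y_orth := by simp
      res := by simp [MinresState.init]
      cone_s := .zero
      cone_w := by simpa [MinresState.init] using ResidualCone.zero
      psd := by simp
      g_mem := ?_ }
  · intro x hx
    rw [bot_sup_eq, Submodule.mem_span_singleton] at hx
    obtain ⟨a, rfl⟩ := hx
    rw [hq, inner_smul_right, inner_sub_left, real_inner_smul_left, real_inner_self_eq_norm_sq, hv,
      real_inner_comm, MinresState.α]
    simp
  · have h1 : (MinresState.init g).γ₁ A = (MinresState.init g).α A := by
      simp [MinresState.init, MinresState.γ₁]
    rw [hy, hq, h1]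
    simp [MinresState.init]
  · rw [bot_sup_eq, Submodule.mem_span_singleton]
    refine ⟨-‖g‖, ?_⟩
    simp [MinresState.init, smul_smul, hn]

namespace MinresInv

lemma r_eq (h : MinresInv A g K S) : S.r = S.φ • S.y := by
  rw [MinresState.y, smul_smul, mul_inv_cancel₀ h.φ_pos.ne', one_smul]

/-- The plane rotation solved for y. The vector c A w + sn y is the preceding normalised residual,
except in the first iteration, where it vanishes. -/
lemma y_eq_sub (h : MinresInv A g K S) :
    S.y = S.sn • (S.c • A S.w + S.sn • S.y) - S.c • S.v := by
  have h1 := h.v_eq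
  have h2 := h.c_sq_add
  linear_combination (norm := module) (-h2) • S.y + S.c • h1

lemma y_mem (h : MinresInv A g K S) : S.y ∈ K ⊔ Submodule.span ℝ {S.v} := by
  rw [h.y_eq_sub]
  refine sub_mem (Submodule.smul_mem _ _ (Submodule.mem_sup_left h.yPrev_mem)) ?_
  exact Submodule.smul_mem _ _ (Submodule.mem_sup_right (Submodule.mem_span_singleton_self _))

lemma v_mem_sup (S : MinresState d) : S.v ∈ K ⊔ Submodule.span ℝ {S.v} :=
  Submodule.mem_sup_right (Submodule.mem_span_singleton_self _)

lemma inner_y_map_v (hA : ∀ x y, inner ℝ (A x) y = inner ℝ x (A y)) (h : MinresInv A g K S) :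
    inner ℝ S.y (A S.v) = S.γ₁ A := by
  rw [← hA, h.map_y, inner_sub_left, real_inner_smul_left, real_inner_smul_left,
    h.q_orth _ (v_mem_sup S), real_inner_self_eq_norm_sq, h.norm_v]
  ring

/-- In y = sn yPrev - c v the first term lies in K and drops out because y ⟂ A K. This is why the
sign of c γ₁ decides the curvature test. -/
lemma inner_y_map_y (hA : ∀ x y, inner ℝ (A x) y = inner ℝ x (A y)) (h : MinresInv A g K S) :
    inner ℝ S.y (A S.y) = -(S.c * S.γ₁ A) := by
  nth_rw 2 [h.y_eq_sub]
  rw [map_sub, map_smul, map_smul, inner_sub_right, inner_smul_right, inner_smul_right,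
    h.inner_y_map_v hA, h.y_orth _ h.yPrev_mem]
  simp

/-- A y = γ₁ v - c q is an orthogonal decomposition, and c q has norm |δNext|. -/
lemma norm_map_y (h : MinresInv A g K S) :
    ‖A S.y‖ = Real.sqrt (S.γ₁ A ^ 2 + S.δNext A ^ 2) := by
  rw [eq_comm, Real.sqrt_eq_iff_eq_sq (by positivity) (norm_nonneg _),
    ← real_inner_self_eq_norm_sq, h.map_y]
  have h1 := h.q_orth _ (v_mem_sup S)
  have h2 : inner ℝ S.v (S.q A) = 0 := by rw [real_inner_comm]; exact h1
  simp only [inner_sub_left, inner_sub_right, real_inner_smul_left, inner_smul_right, h1, h2,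
    real_inner_self_eq_norm_sq, h.norm_v, MinresState.δNext, MinresState.βNext]
  ring

lemma norm_r (h : MinresInv A g K S) : ‖S.r‖ = S.φ := by
  rw [h.r_eq, norm_smul, h.norm_y, Real.norm_of_nonneg h.φ_pos.le, mul_one]

lemma norm_map_r (h : MinresInv A g K S) :
    ‖A S.r‖ = S.φ * Real.sqrt (S.γ₁ A ^ 2 + S.δNext A ^ 2) := by
  rw [h.r_eq, map_smul, norm_smul, h.norm_map_y, Real.norm_of_nonneg h.φ_pos.le]

lemma inner_r_map_s (h : MinresInv A g K S) : inner ℝ S.r (A S.s) = 0 := by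
  rw [h.r_eq, real_inner_smul_left, h.y_orth _ h.s_mem, mul_zero]

/-- Pythagoras for g = -A s - r with r ⟂ A s. Together with `norm_map_r` it turns the scalar
inexactness test into ‖A r‖ ≤ η ‖A s‖. -/
lemma norm_map_s (h : MinresInv A g K S) : ‖A S.s‖ = Real.sqrt (‖g‖ ^ 2 - S.φ ^ 2) := by
  have hg : g = -A S.s - S.r := by rw [h.res]; abel
  have h1 := h.inner_r_map_s
  have h2 : ‖g‖ ^ 2 = ‖A S.s‖ ^ 2 + S.φ ^ 2 := by
    rw [← h.norm_r]
    nth_rw 1 [hg]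
    rw [norm_sub_sq_real, inner_neg_left, real_inner_comm, h1, norm_neg]
    ring
  rw [h2, add_sub_cancel_right, Real.sqrt_sq (norm_nonneg _)]

lemma inner_g_r (h : MinresInv A g K S) : inner ℝ g S.r = -‖S.r‖ ^ 2 := by
  have hg : g = -A S.s - S.r := by rw [h.res]; abel
  nth_rw 1 [hg]
  rw [inner_sub_left, inner_neg_left, real_inner_comm, h.inner_r_map_s, real_inner_self_eq_norm_sq]
  ring

/-- As c ≠ 0, y can replace v as the new generator; unlike v, it is orthogonal to A K. -/
lemma sup_span_v_le (h : MinresInv A g K S) :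
    K ⊔ Submodule.span ℝ {S.v} ≤ K ⊔ Submodule.span ℝ {S.y} := by
  refine sup_le le_sup_left ?_
  rw [Submodule.span_singleton_le_iff_mem]
  have h1 : S.v = S.c⁻¹ • (S.sn • (S.c • A S.w + S.sn • S.y) - S.y) := by
    rw [eq_inv_smul_iff₀ h.c_ne]
    nth_rw 2 [h.y_eq_sub]
    abel
  rw [h1]
  exact Submodule.smul_mem _ _ (sub_mem (Submodule.smul_mem _ _
    (Submodule.mem_sup_left h.yPrev_mem))
    (Submodule.mem_sup_right (Submodule.mem_span_singleton_self _)))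

/-- In the splitting K + ℝ y the quadratic form of A has no cross terms, and ⟨y, A y⟩ = -c γ₁. -/
lemma psd_sup (hA : ∀ x y, inner ℝ (A x) y = inner ℝ x (A y)) (h : MinresInv A g K S)
    (hc : S.c * S.γ₁ A ≤ 0) : ∀ x ∈ K ⊔ Submodule.span ℝ {S.v}, 0 ≤ inner ℝ x (A x) := by
  intro x hx
  obtain ⟨k, hk, z, hz, rfl⟩ := Submodule.mem_sup.1 (h.sup_span_v_le hx)
  obtain ⟨a, rfl⟩ := Submodule.mem_span_singleton.1 hz
  have h1 := h.psd k hk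
  have h2 := h.y_orth k hk
  have h3 : inner ℝ k (A S.y) = 0 := by rw [← hA, real_inner_comm]; exact h2
  simp only [map_add, map_smul, inner_add_left, inner_add_right, real_inner_smul_left,
    inner_smul_right, h2, h3, h.inner_y_map_y hA]
  nlinarith [mul_nonneg (mul_self_nonneg a) (neg_nonneg.2 hc)]

/-- Only the q-component of A v leaves the space: q ≠ 0 gives the next Lanczos vector, q = 0 gives
invariance. -/
lemma map_sup_mem (h : MinresInv A g K S) :
    ∀ x ∈ K ⊔ Submodule.span ℝ {S.v}, ∃ a : ℝ, A x - a • S.q A ∈ K ⊔ Submodule.span ℝ {S.v} := by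
  intro x hx
  obtain ⟨k, hk, z, hz, rfl⟩ := Submodule.mem_sup.1 hx
  obtain ⟨a, rfl⟩ := Submodule.mem_span_singleton.1 hz
  refine ⟨a, ?_⟩
  have h1 : A (k + a • S.v) - a • S.q A = A k + (a * S.β) • S.vPrev + (a * S.α A) • S.v := by
    rw [map_add, map_smul, S.map_v A]; module
  rw [h1]
  exact add_mem (add_mem (h.map_mem k hk)
    (Submodule.smul_mem _ _ (Submodule.mem_sup_left h.vPrev_mem)))
    (Submodule.smul_mem _ _ (v_mem_sup S))

end MinresInv

end MinresTheory

/-! ### Preservation of the invariants by one MINRES iteration -/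

section MinresStep

variable {d : ℕ} {A : Vec d →L[ℝ] Vec d} {g : Vec d} {K : Submodule ℝ (Vec d)} {S : MinresState d}

/-- A failed curvature test excludes the degenerate branch of `MinresState.next`. -/
lemma MinresState.γ₂_ne_zero (hc : S.c * S.γ₁ A < 0) : S.γ₂ A ≠ 0 := by
  have h1 : S.γ₁ A ≠ 0 := fun h => by simp [h] at hc
  rw [MinresState.γ₂, Real.sqrt_ne_zero (by positivity)]
  positivity

lemma MinresState.γ₂_sq (A : Vec d →L[ℝ] Vec d) (S : MinresState d) :
    S.γ₂ A ^ 2 = S.γ₁ A ^ 2 + S.βNext A ^ 2 := by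
  rw [MinresState.γ₂, Real.sq_sqrt (by positivity)]

namespace MinresInv

/-- The image of the next direction `w`. -/
lemma map_wNext (h : MinresInv A g K S) (hγ : S.γ₂ A ≠ 0) :
    S.γ₂ A • A (S.next A).w = S.γ₁ A • S.y + S.q A := by
  have h1 := S.map_v A
  have h2 := h.v_eq
  have h3 := h.prev_eq
  have h4 := h.c_sq_add
  have h5 : S.γ₂ A • A (S.next A).w = A S.v - S.δ₂ A • A S.w - S.ϵ • A S.wPrev := by
    simp only [MinresState.next, hγ, ne_eq, not_false_eq_true, if_true]
    rw [map_smul, smul_smul, mul_inv_cancel₀ hγ, one_smul, map_sub, map_sub, map_smul, map_smul]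
  rw [h5, h1, h3, MinresState.δ₂, MinresState.γ₁]
  linear_combination (norm := module) (S.α A) • h2

/-- Solving `y_eq` for the new w expresses c' w' as a combination of the residual direction y and
the old c w. Both coefficients are nonnegative because c γ₁ < 0 and sn ≥ 0. -/
lemma cone_wNext (h : MinresInv A g K S) (hc : S.c * S.γ₁ A < 0) :
    ResidualCone A g (K ⊔ Submodule.span ℝ {S.v}) ((S.next A).c • (S.next A).w) := by
  have hγ := MinresState.γ₂_ne_zero hc
  have hγ1 : S.γ₁ A ≠ 0 := fun h => by simp [h] at hc
  have hy : ResidualCone A g K S.y := by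
    have := (ResidualCone.residual (A := A) (g := g) h.s_mem).smul (inv_nonneg.2 h.φ_pos.le)
    rwa [← h.res] at this
  have hr : (S.next A).c • (S.next A).w =
      (-(S.c * S.γ₁ A) / (S.c ^ 2 * S.γ₂ A ^ 2)) • (S.y
        + (S.sn * (-(S.c * S.γ₁ A) / S.c ^ 2)) • (S.c • S.w)) := by
    have h1 : S.γ₂ A • (S.next A).w = S.v - S.δ₂ A • S.w - S.ϵ • S.wPrev := by
      simp only [MinresState.next, hγ, ne_eq, not_false_eq_true, if_true]
      rw [smul_smul, mul_inv_cancel₀ hγ, one_smul]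
    have h2 : (S.next A).c = S.γ₁ A / S.γ₂ A := by
      simp only [MinresState.next, hγ, ne_eq, not_false_eq_true, if_true]
    have h3 := h.y_eq
    rw [← h1] at h3
    have hcne := h.c_ne
    have h4 : (S.next A).w = (-(S.c * S.γ₂ A)⁻¹) • (S.y - (S.γ₁ A * S.sn) • S.w) := by
      rw [h3]
      have : (S.c * S.γ₂ A)⁻¹ * (S.c * S.γ₂ A) = 1 := inv_mul_cancel₀ (mul_ne_zero hcne hγ)
      linear_combination (norm := module) (-this) • (S.next A).w
    rw [h2, h4]
    match_scalars <;> field_simp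
  rw [hr]
  refine (((hy.add (h.cone_w.smul ?_)).smul ?_)).mono le_sup_left
  · have := h.sn_nonneg
    exact mul_nonneg this (div_nonneg (by linarith) (by positivity))
  · exact div_nonneg (by linarith) (by positivity)

lemma cone_sNext (h : MinresInv A g K S) (hc : S.c * S.γ₁ A < 0) :
    ResidualCone A g (K ⊔ Submodule.span ℝ {S.v}) (S.next A).s := by
  have hγ := MinresState.γ₂_ne_zero hc
  have h1 : (S.next A).s = S.s + S.φ • ((S.next A).c • (S.next A).w) := by
    simp only [MinresState.next, hγ, ne_eq, not_false_eq_true, if_true]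
    module
  rw [h1]
  exact (h.cone_s.mono le_sup_left).add ((h.cone_wNext hc).smul h.φ_pos.le)

lemma wNext_mem (h : MinresInv A g K S) (hγ : S.γ₂ A ≠ 0) :
    (S.next A).w ∈ K ⊔ Submodule.span ℝ {S.v} := by
  simp only [MinresState.next, hγ, ne_eq, not_false_eq_true, if_true]
  exact Submodule.smul_mem _ _ (sub_mem (sub_mem (v_mem_sup S)
    (Submodule.smul_mem _ _ (Submodule.mem_sup_left h.w_mem)))
    (Submodule.smul_mem _ _ (Submodule.mem_sup_left h.wPrev_mem)))

lemma sNext_mem (h : MinresInv A g K S) (hγ : S.γ₂ A ≠ 0) :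
    (S.next A).s ∈ K ⊔ Submodule.span ℝ {S.v} := by
  have hw := h.wNext_mem hγ
  have h1 : (S.next A).s = S.s + (S.φ * (S.next A).c) • (S.next A).w := by
    simp only [MinresState.next, hγ, ne_eq, not_false_eq_true, if_true]
    module
  rw [h1]
  exact add_mem (Submodule.mem_sup_left h.s_mem) (Submodule.smul_mem _ _ hw)

/-- Everything follows from the new rotation: A w' = c' y + sn' v' and y' = sn' y - c' v' with c'² +
sn'² = 1, where y and v' are orthonormal. -/
lemma next (hA : ∀ x y, inner ℝ (A x) y = inner ℝ x (A y)) (h : MinresInv A g K S)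
    (hc : S.c * S.γ₁ A < 0) (hβ : S.βNext A ≠ 0) :
    MinresInv A g (K ⊔ Submodule.span ℝ {S.v}) (S.next A) := by
  have hγ := MinresState.γ₂_ne_zero hc
  have hγsq := S.γ₂_sq A
  have hγ1 : S.γ₁ A ≠ 0 := fun h => by simp [h] at hc
  have hβpos : 0 < S.βNext A := lt_of_le_of_ne (norm_nonneg _) hβ.symm
  have hγpos : 0 < S.γ₂ A := lt_of_le_of_ne (Real.sqrt_nonneg _) hγ.symm
  set S' := S.next A with hS'
  have eβ : S'.β = S.βNext A := by simp [hS', MinresState.next, hγ]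
  have eδ : S'.δ₁ = -S.c * S.βNext A := by simp [hS', MinresState.next, hγ, MinresState.δNext]
  have eϵ : S'.ϵ = S.sn * S.βNext A := by simp [hS', MinresState.next, hγ, MinresState.ϵNext]
  have ec : S'.c = S.γ₁ A / S.γ₂ A := by simp [hS', MinresState.next, hγ]
  have es : S'.sn = S.βNext A / S.γ₂ A := by simp [hS', MinresState.next, hγ]
  have eφ : S'.φ = S'.sn * S.φ := by simp [hS', MinresState.next, hγ]
  have ewp : S'.wPrev = S.w := by simp [hS', MinresState.next, hγ]
  have evp : S'.vPrev = S.v := by simp [hS', MinresState.next, hγ]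
  have ev : S'.v = (S.βNext A)⁻¹ • S.q A := by simp [hS', MinresState.next, hγ, hβ]
  have er : S'.r = S'.sn ^ 2 • S.r - (S'.φ * S'.c) • S'.v := by
    simp [hS', MinresState.next, hγ, hβ]
  have ess : S'.s = S.s + (S'.c * S.φ) • S'.w := by simp [hS', MinresState.next, hγ]
  have ew : S.γ₂ A • S'.w = S.v - S.δ₂ A • S.w - S.ϵ • S.wPrev := by
    simp [hS', MinresState.next, hγ, smul_smul]
  have hAw := h.map_wNext hγ
  rw [← hS'] at hAw
  have hq : S.q A = S.βNext A • S'.v := by rw [ev, smul_smul, mul_inv_cancel₀ hβ, one_smul]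
  have hsn : 0 < S'.sn := by rw [es]; positivity
  have hφ : 0 < S'.φ := by rw [eφ]; exact mul_pos hsn h.φ_pos
  have hcs : S'.c ^ 2 + S'.sn ^ 2 = 1 := by
    rw [ec, es]; field_simp; exact hγsq.symm
  have hγ1' : S.γ₁ A = S'.c * S.γ₂ A := by rw [ec]; field_simp
  have hβ' : S.βNext A = S'.sn * S.γ₂ A := by rw [es]; field_simp
  have hy : S'.y = S'.sn • S.y - S'.c • S'.v := by
    rw [MinresState.y, inv_smul_eq_iff₀ hφ.ne', er, h.r_eq, eφ]
    module
  have hAw' : A S'.w = S'.c • S.y + S'.sn • S'.v := by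
    have h1 : S.γ₂ A • A S'.w = S.γ₂ A • (S'.c • S.y + S'.sn • S'.v) := by
      rw [hAw, hq, hγ1', hβ']; module
    exact smul_right_injective _ hγ h1
  have hv1 : ‖S'.v‖ = 1 := by
    rw [ev, norm_smul, norm_inv, Real.norm_of_nonneg hβpos.le]
    exact inv_mul_cancel₀ hβ
  have hvo : ∀ x ∈ K ⊔ Submodule.span ℝ {S.v}, inner ℝ S'.v x = 0 := fun x hx => by
    rw [ev, real_inner_smul_left, h.q_orth x hx, mul_zero]
  have hvo' : ∀ x ∈ K ⊔ Submodule.span ℝ {S.v}, inner ℝ x S'.v = 0 := fun x hx => by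
    rw [real_inner_comm]; exact hvo x hx
  have hmap : ∀ x ∈ K ⊔ Submodule.span ℝ {S.v},
      A x ∈ K ⊔ Submodule.span ℝ {S.v} ⊔ Submodule.span ℝ {S'.v} := fun x hx => by
    obtain ⟨a, ha⟩ := h.map_sup_mem x hx
    have h1 : A x = (A x - a • S.q A) + (a * S.βNext A) • S'.v := by rw [hq]; module
    rw [h1]
    exact add_mem (Submodule.mem_sup_left ha) (Submodule.smul_mem _ _ (v_mem_sup S'))
  have hvv : inner ℝ S'.v S.v = 0 := hvo _ (v_mem_sup S)
  have hAv' : A S'.v = S.βNext A • S.v + S'.α A • S'.v + S'.q A := by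
    rw [← eβ, ← evp]; exact S'.map_v A
  have hγ1n : S'.γ₁ A = S'.sn * (-S.c * S.βNext A) - S'.c * S'.α A := by
    rw [MinresState.γ₁, eδ]
  have hδ2n : S'.δ₂ A = S'.c * (-S.c * S.βNext A) + S'.sn * S'.α A := by
    rw [MinresState.δ₂, eδ]
  refine
    { norm_v := hv1
      v_orth := hvo
      vPrev_mem := by rw [evp]; exact v_mem_sup S
      map_mem := hmap
      q_orth := ?_
      φ_pos := hφ
      norm_y := ?_
      sn_nonneg := hsn.le
      c_sq_add := hcs
      c_ne := by rw [ec]; exact div_ne_zero hγ1 hγ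
      v_eq := ?_
      prev_eq := ?_
      map_y := ?_
      y_eq := ?_
      yPrev_mem := ?_
      w_mem := h.wNext_mem hγ
      wPrev_mem := by rw [ewp]; exact Submodule.mem_sup_left h.w_mem
      s_mem := h.sNext_mem hγ
      y_orth := ?_
      res := ?_
      cone_s := h.cone_sNext hc
      cone_w := h.cone_wNext hc
      psd := h.psd_sup hA hc.le
      g_mem := Submodule.mem_sup_left h.g_mem }
  · -- orthogonality of the next Lanczos vector
    have hqv : ∀ x, inner ℝ (S'.q A) x = inner ℝ S'.v (A x) - S.βNext A * inner ℝ S.v x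
        - S'.α A * inner ℝ S'.v x := fun x => by
      rw [MinresState.q, eβ, evp, inner_sub_left, inner_sub_left, real_inner_smul_left,
        real_inner_smul_left, hA]
    intro x hx
    obtain ⟨x1, hx1, z', hz', rfl⟩ := Submodule.mem_sup.1 hx
    obtain ⟨b, rfl⟩ := Submodule.mem_span_singleton.1 hz'
    obtain ⟨k, hk, z, hz, rfl⟩ := Submodule.mem_sup.1 hx1
    obtain ⟨a, rfl⟩ := Submodule.mem_span_singleton.1 hz
    -- By symmetry A moves onto k, and A k stays in K + ℝ v, to which the new vector is orthogonal.
    -- Hence orthogonalising against two vectors suffices.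
    have e1 : inner ℝ (S'.q A) k = 0 := by
      rw [hqv, hvo _ (h.map_mem k hk), h.v_orth k hk, hvo _ (Submodule.mem_sup_left hk)]; ring
    have e2 : inner ℝ (S'.q A) S.v = 0 := by
      rw [hqv, S.map_v A, inner_add_right, inner_add_right, inner_smul_right, inner_smul_right,
        hvo _ (Submodule.mem_sup_left h.vPrev_mem), hvv, hq, inner_smul_right,
        real_inner_self_eq_norm_sq, real_inner_self_eq_norm_sq, hv1, h.norm_v]; ring
    have e3 : inner ℝ (S'.q A) S'.v = 0 := by
      rw [hqv, hvo' _ (v_mem_sup S), real_inner_self_eq_norm_sq, hv1, MinresState.α]; ring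
    rw [inner_add_right, inner_add_right, inner_smul_right, inner_smul_right, e1, e2, e3]; ring
  · have h1 : ‖S'.y‖ ^ 2 = 1 := by
      rw [hy, ← real_inner_self_eq_norm_sq]
      simp only [inner_sub_left, inner_sub_right, real_inner_smul_left, inner_smul_right,
        hvo _ h.y_mem, hvo' _ h.y_mem, real_inner_self_eq_norm_sq, h.norm_y, hv1]
      linarith
    nlinarith [norm_nonneg S'.y]
  · rw [hAw', hy]
    linear_combination (norm := module) (-hcs) • S'.v
  · rw [eβ, evp, eδ, eϵ, ewp, hAw', hy]
    have h1 := h.v_eq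
    linear_combination (norm := module) (S.βNext A) • h1 + (S.c * S.βNext A * hcs) • S.y
  · rw [hy, map_sub, map_smul, map_smul, h.map_y, hAv', hγ1n, hq]
    have h1 : S'.sn * S.γ₁ A = S'.c * S.βNext A := by rw [hγ1', hβ']; ring
    linear_combination (norm := module) h1 • S.v
  · have h3 := h.y_eq
    rw [← ew] at h3
    rw [hy, h3, hγ1n, hδ2n, eϵ, ewp]
    have h1 : S'.sn * S.γ₁ A = S'.c * S.βNext A := by rw [hγ1', hβ']; ring
    linear_combination (norm := module) (S.sn * h1) • S.w + (S.c * S.βNext A * hcs + S.c * hβ') • S'.w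
  -- Rotating back recovers the preceding normalised residual.
  · have h1 : S'.c • A S'.w + S'.sn • S'.y = S.y := by
      rw [hAw', hy]; linear_combination (norm := module) hcs • S.y
    rw [h1]; exact h.y_mem
  · intro x hx
    obtain ⟨k, hk, z, hz, rfl⟩ := Submodule.mem_sup.1 hx
    obtain ⟨a, rfl⟩ := Submodule.mem_span_singleton.1 hz
    have e1 : inner ℝ S'.v (A S.v) = S.βNext A := by
      rw [S.map_v A, inner_add_right, inner_add_right, inner_smul_right, inner_smul_right,
        hvo _ (Submodule.mem_sup_left h.vPrev_mem), hvv, hq, inner_smul_right,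
        real_inner_self_eq_norm_sq, hv1]; ring
    rw [hy, map_add, map_smul, inner_add_right, inner_smul_right, inner_sub_left, inner_sub_left,
      real_inner_smul_left, real_inner_smul_left, real_inner_smul_left, real_inner_smul_left,
      h.y_orth k hk, h.inner_y_map_v hA, hvo _ (h.map_mem k hk), e1, hγ1', hβ']
    ring
  · rw [ess, map_add, map_smul, hAw', er, eφ]
    have h1 := h.res
    have h2 := h.r_eq
    linear_combination (norm := module) h1 - (S'.c ^ 2) • h2 + hcs • S.r
end MinresInv

end MinresStep

/-! ### Termination of MINRES and properties of its output -/

section MinresResults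

variable {d : ℕ} {A : Vec d →L[ℝ] Vec d} {g : Vec d} {η σ : ℝ} {K : Submodule ℝ (Vec d)}
  {S : MinresState d}

/-- The span of the first `n` Lanczos vectors. -/
noncomputable def krylov (A : Vec d →L[ℝ] Vec d) (g : Vec d) : ℕ → Submodule ℝ (Vec d)
  | 0 => ⊥
  | n + 1 => krylov A g n ⊔ Submodule.span ℝ {(minresState A g n).v}

lemma krylov_mono : Monotone (krylov A g) := monotone_nat_of_le_succ fun _ => le_sup_left

lemma v_mem_krylov {i n : ℕ} (h : i < n) : (minresState A g i).v ∈ krylov A g n :=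
  krylov_mono h (Submodule.mem_sup_right (Submodule.mem_span_singleton_self _))

lemma exists_sum_of_mem_krylov (n : ℕ) : ∀ x ∈ krylov A g n,
    ∃ a : ℕ → ℝ, x = ∑ i ∈ Finset.range n, a i • (minresState A g i).v := by
  induction n with
  | zero => intro x hx; exact ⟨0, by simpa [krylov] using hx⟩
  | succ n ih =>
    intro x hx
    obtain ⟨k, hk, z, hz, rfl⟩ := Submodule.mem_sup.1 hx
    obtain ⟨b, rfl⟩ := Submodule.mem_span_singleton.1 hz
    obtain ⟨a, rfl⟩ := ih k hk
    refine ⟨Function.update a n b, ?_⟩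
    rw [Finset.sum_range_succ, Function.update_self]
    congr 1
    refine Finset.sum_congr rfl fun i hi => ?_
    rw [Function.update_of_ne (Finset.mem_range.1 hi).ne]

namespace MinresInv

lemma next_φ_of_exhausted (hβ : S.βNext A = 0) (hc : S.c * S.γ₁ A < 0) : (S.next A).φ = 0 := by
  have hγ := MinresState.γ₂_ne_zero hc
  simp [MinresState.next, hγ, hβ]

/-- With q = 0 the rotation is trivial, |γ₁| = γ₂, so the update of s adds exactly r to A s and the
linear system is solved. -/
lemma next_res_of_exhausted (h : MinresInv A g K S) (hβ : S.βNext A = 0)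
    (hc : S.c * S.γ₁ A < 0) : -A (S.next A).s - g = 0 := by
  have hγ := MinresState.γ₂_ne_zero hc
  have hγsq := S.γ₂_sq A
  have hγ1 : S.γ₁ A ≠ 0 := fun h => by simp [h] at hc
  have hq : S.q A = 0 := norm_eq_zero.1 hβ
  have h1 : (S.next A).s = S.s + (S.φ * (S.γ₁ A / S.γ₂ A)) • (S.next A).w := by
    simp only [MinresState.next, hγ, ne_eq, not_false_eq_true, if_true]
    module
  have h2 : A (S.next A).w = (S.γ₁ A / S.γ₂ A) • S.y := by
    have h3 := h.map_wNext hγ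
    rw [hq, add_zero] at h3
    rw [div_eq_inv_mul, mul_smul, ← h3, smul_smul, inv_mul_cancel₀ hγ, one_smul]
  have h4 : (S.γ₁ A / S.γ₂ A) * (S.γ₁ A / S.γ₂ A) = 1 := by
    rw [hβ] at hγsq
    field_simp
    linarith
  rw [h1, map_add, map_smul, h2, smul_smul, mul_assoc, h4, mul_one, ← h.r_eq, h.res]
  abel

lemma map_mem_of_exhausted (h : MinresInv A g K S) (hβ : S.βNext A = 0) :
    ∀ x ∈ K ⊔ Submodule.span ℝ {S.v}, A x ∈ K ⊔ Submodule.span ℝ {S.v} := by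
  have hq : S.q A = 0 := norm_eq_zero.1 hβ
  intro x hx
  obtain ⟨a, ha⟩ := h.map_sup_mem x hx
  simpa [hq] using ha

end MinresInv

/-- After exhaustion v and φ are zero, so `MinresInv` cannot persist; the second alternative
remembers where that happened. -/
lemma minresState_inv_or_exhausted (hA : ∀ x y, inner ℝ (A x) y = inner ℝ x (A y)) (hg : g ≠ 0)
    (j : ℕ) (hj : ∀ i < j, ¬ minresNpcTest A g i) :
    (∀ i ≤ j, MinresInv A g (krylov A g i) (minresState A g i)) ∨
      ∃ i < j, (minresState A g i).βNext A = 0 ∧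
        ∀ k ≤ i, MinresInv A g (krylov A g k) (minresState A g k) := by
  induction j with
  | zero =>
    left
    intro i hi
    obtain rfl := Nat.le_zero.1 hi
    exact MinresInv.init hg
  | succ j ih =>
    rcases ih fun i hi => hj i (hi.trans j.lt_succ_self) with h | ⟨i, hi, h⟩
    · by_cases hβ : (minresState A g j).βNext A = 0
      · exact Or.inr ⟨j, j.lt_succ_self, hβ, h⟩
      · left
        intro i hi
        rcases Nat.le_succ_iff.1 hi with hi | rfl
        · exact h i hi
        · exact (h j le_rfl).next hA (not_le.1 (hj j j.lt_succ_self)) hβ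
    · exact Or.inr ⟨i, hi.trans j.lt_succ_self, h⟩

/-- The next φ is zero, so the left side of the inexactness test vanishes. -/
lemma minresSolTest_of_exhausted (hη : 0 ≤ η) {i : ℕ} (hβ : (minresState A g i).βNext A = 0)
    (hc : ¬ minresNpcTest A g i) : minresSolTest A g η (i + 1) := by
  have h := MinresInv.next_φ_of_exhausted hβ (not_le.1 hc)
  have h' : (minresState A g (i + 1)).φ = 0 := h
  simp only [minresSolTest, h', zero_mul]
  positivity

/-- When no test has succeeded before, either the invariants hold or the Krylov space has just
been exhausted. -/
lemma minresState_inv_or_just_exhausted (hA : ∀ x y, inner ℝ (A x) y = inner ℝ x (A y))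
    (hg : g ≠ 0) (hη : 0 ≤ η) (j : ℕ)
    (hj : ∀ i < j, ¬ minresSolTest A g η i ∧ ¬ minresNpcTest A g i) :
    (∀ i ≤ j, MinresInv A g (krylov A g i) (minresState A g i)) ∨
      ∃ i, j = i + 1 ∧ (minresState A g i).βNext A = 0 ∧
        ∀ k ≤ i, MinresInv A g (krylov A g k) (minresState A g k) := by
  rcases minresState_inv_or_exhausted hA hg j fun i hi => (hj i hi).2 with h | ⟨i, hi, hβ, h⟩
  · exact Or.inl h
  · refine Or.inr ⟨i, ?_, hβ, h⟩
    by_contra hne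
    exact (hj (i + 1) (by omega)).1 (minresSolTest_of_exhausted hη hβ (hj i hi).2)

/-- MINRES terminates. -/
lemma exists_minresTest (hA : ∀ x y, inner ℝ (A x) y = inner ℝ x (A y))
    (hg : g ≠ 0) (hη : 0 ≤ η) : ∃ j, minresSolTest A g η j ∨ minresNpcTest A g j := by
  by_contra hcon
  push Not at hcon
  have hinv : ∀ j, MinresInv A g (krylov A g j) (minresState A g j) := fun j => by
    rcases minresState_inv_or_just_exhausted hA hg hη j fun i _ => hcon i with h | ⟨i, -, hβ, -⟩
    · exact h j le_rfl
    · exact absurd (minresSolTest_of_exhausted hη hβ (hcon i).2) (hcon (i + 1)).1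
  -- Without a stop each v is a unit vector orthogonal to its predecessors, so the Krylov dimension
  -- would outgrow d.
  have hrank : ∀ j, j ≤ Module.finrank ℝ (krylov A g j) := fun j => by
    induction j with
    | zero => exact Nat.zero_le _
    | succ j ih =>
      refine Nat.succ_le_of_lt (ih.trans_lt (Submodule.finrank_lt_finrank_of_lt ?_))
      refine lt_of_le_of_ne le_sup_left fun heq => ?_
      have hmem : (minresState A g j).v ∈ krylov A g j := by
        have := v_mem_krylov (A := A) (g := g) j.lt_succ_self
        rwa [← heq] at this
      have h1 := (hinv j).v_orth _ hmem
      rw [real_inner_self_eq_norm_sq, (hinv j).norm_v] at h1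
      norm_num at h1
  have h1 := hrank (d + 1)
  have h2 := Submodule.finrank_le (krylov A g (d + 1))
  rw [finrank_euclideanSpace_fin] at h2
  omega

/-- The Lanczos vectors are orthonormal, so passing to coordinates is an isometry that turns ⟨x, A
x⟩ into the form of T_n. -/
lemma inner_ge_of_lanczosMatrix {n : ℕ}
    (hinv : ∀ i < n, MinresInv A g (krylov A g i) (minresState A g i))
    (hT : (lanczosMatrix A g n - σ • (1 : Matrix (Fin n) (Fin n) ℝ)).PosSemidef) :
    ∀ x ∈ krylov A g n, σ * ‖x‖ ^ 2 ≤ inner ℝ x (A x) := by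
  intro x hx
  obtain ⟨a, ha⟩ := exists_sum_of_mem_krylov n x hx
  set b : Fin n → ℝ := fun i => a i
  set V : Fin n → Vec d := fun i => (minresState A g i).v
  have hxV : x = ∑ i, b i • V i := by
    rw [ha, Finset.sum_range]
  have hV : Orthonormal ℝ V := by
    refine ⟨fun i => (hinv i i.2).norm_v, ?_⟩
    have hlt : ∀ i k : Fin n, i < k → inner ℝ (V k) (V i) = 0 := fun i k hik =>
      (hinv k k.2).v_orth _ (v_mem_krylov hik)
    intro i k hik
    rcases lt_or_gt_of_ne hik with h | h
    · rw [real_inner_comm]; exact hlt i k h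
    · exact hlt k i h
  have h1 := hT.dotProduct_mulVec_nonneg b
  have h2 : inner ℝ x (A x) = star b ⬝ᵥ (lanczosMatrix A g n).mulVec b := by
    rw [hxV, map_sum, sum_inner]
    simp only [dotProduct, Matrix.mulVec, star_trivial]
    refine Finset.sum_congr rfl fun i _ => ?_
    rw [real_inner_smul_left, inner_sum]
    congr 1
    refine Finset.sum_congr rfl fun k _ => ?_
    rw [map_smul, inner_smul_right, mul_comm]
    rfl
  have h3 : ‖x‖ ^ 2 = star b ⬝ᵥ b := by
    rw [hxV, ← real_inner_self_eq_norm_sq, hV.inner_sum]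
    simp [dotProduct]
  rw [Matrix.sub_mulVec, dotProduct_sub, Matrix.smul_mulVec, Matrix.one_mulVec, dotProduct_smul,
    ← h2, ← h3, smul_eq_mul] at h1
  linarith

/-- The inexactness test succeeds in iteration `j + 1`, and no test has succeeded before. -/
def MinresStopSol (A : Vec d →L[ℝ] Vec d) (g : Vec d) (η : ℝ) (j : ℕ) : Prop :=
  minresSolTest A g η j ∧ ∀ i < j, ¬ minresSolTest A g η i ∧ ¬ minresNpcTest A g i

/-- The curvature test succeeds in iteration `j + 1`, and no test has succeeded before. -/
def MinresStopNpc (A : Vec d →L[ℝ] Vec d) (g : Vec d) (η : ℝ) (j : ℕ) : Prop :=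
  (¬ minresSolTest A g η j ∧ minresNpcTest A g j) ∧
    ∀ i < j, ¬ minresSolTest A g η i ∧ ¬ minresNpcTest A g i

lemma minres_eq_of_stopSol {j : ℕ} (h : MinresStopSol A g η j) :
    minres A g η = some ((minresState A g j).s, DirType.SOL) := by
  classical
  have hex : ∃ j, minresSolTest A g η j ∨ minresNpcTest A g j := ⟨j, Or.inl h.1⟩
  have hfind : Nat.find hex = j :=
    (Nat.find_eq_iff hex).2 ⟨Or.inl h.1, fun i hi => not_or.2 (h.2 i hi)⟩
  have h1 := h.1
  rw [minres, dif_pos hex]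
  split_ifs with h2
  · convert rfl
    convert hfind.symm
  · exact absurd (by convert h1) h2

lemma minres_eq_of_stopNpc {j : ℕ} (h : MinresStopNpc A g η j) :
    minres A g η = some ((minresState A g j).r, DirType.NPC) := by
  classical
  have hex : ∃ j, minresSolTest A g η j ∨ minresNpcTest A g j := ⟨j, Or.inr h.1.2⟩
  have hfind : Nat.find hex = j :=
    (Nat.find_eq_iff hex).2 ⟨Or.inr h.1.2, fun i hi => not_or.2 (h.2 i hi)⟩
  have h1 := h.1.1
  rw [minres, dif_pos hex]
  split_ifs with h2
  · exact absurd (by convert h2; convert hfind.symm) h1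
  · convert rfl
    convert hfind.symm

lemma exists_stop (hA : ∀ x y, inner ℝ (A x) y = inner ℝ x (A y)) (hg : g ≠ 0) (hη : 0 ≤ η) :
    (∃ j, MinresStopSol A g η j) ∨ ∃ j, MinresStopNpc A g η j := by
  classical
  have hex := exists_minresTest hA hg hη
  have hmin : ∀ i < Nat.find hex, ¬ minresSolTest A g η i ∧ ¬ minresNpcTest A g i :=
    fun i hi => not_or.1 (Nat.find_min hex hi)
  by_cases h : minresSolTest A g η (Nat.find hex)
  · exact Or.inl ⟨_, h, hmin⟩
  · exact Or.inr ⟨_, ⟨h, (Nat.find_spec hex).resolve_left h⟩, hmin⟩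

/-- Properties of the direction returned with type `SOL`. -/
theorem MinresStopSol.properties (hA : ∀ x y, inner ℝ (A x) y = inner ℝ x (A y)) (hg : g ≠ 0)
    (hη : 0 ≤ η)
    (hreg : ∀ j, minresNpcNotDetected A g η j → (minresState A g j).v ≠ 0 →
      (lanczosMatrix A g (j + 1) - σ • (1 : Matrix (Fin (j + 1)) (Fin (j + 1)) ℝ)).PosSemidef)
    {j : ℕ} (h : MinresStopSol A g η j) {s r : Vec d} (hs : s = (minresState A g j).s)
    (hr : r = -A s - g) :
    0 ≤ inner ℝ s r ∧ σ * ‖s‖ ^ 2 ≤ inner ℝ s (A s) ∧ ‖A r‖ ≤ η * ‖A s‖ ∧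
      σ * ‖r‖ ^ 2 ≤ inner ℝ r (A r) := by
  have hreg' : ∀ j, minresNpcNotDetected A g η j →
      (∀ i ≤ j, MinresInv A g (krylov A g i) (minresState A g i)) →
      ∀ x ∈ krylov A g (j + 1), σ * ‖x‖ ^ 2 ≤ inner ℝ x (A x) := fun j hj hinv => by
    refine inner_ge_of_lanczosMatrix (fun i hi => hinv i (Nat.lt_succ_iff.1 hi)) (hreg j hj ?_)
    have := (hinv j le_rfl).norm_v
    exact norm_ne_zero_iff.1 (by rw [this]; exact one_ne_zero)
  rcases minresState_inv_or_just_exhausted hA hg hη j h.2 with hinv | ⟨i, rfl, hβ, hinv⟩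
  · have hj := hinv j le_rfl
    have hr' : r = (minresState A g j).r := by rw [hr, hs, hj.res]
    -- The index is j + 1 because r lies in the Krylov space enlarged by v, whereas s already lies
    -- in the smaller one.
    have hpos := hreg' j ⟨h.2, Or.inl h.1⟩ hinv
    refine ⟨?_, ?_, ?_, ?_⟩
    · obtain ⟨m, hm, hcone⟩ := hj.cone_s
      have h1 : inner ℝ s r = m * ‖r‖ ^ 2 := by
        rw [hr', hs, hcone, inner_neg_left, hj.inner_g_r, neg_neg]
        intro k hk
        rw [hj.r_eq, real_inner_smul_left, hj.y_orth k hk, mul_zero]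
      rw [h1]; positivity
    · rw [hs]; exact hpos _ (Submodule.mem_sup_left hj.s_mem)
    · rw [hr', hs, hj.norm_map_r, hj.norm_map_s]; exact h.1
    · rw [hr']
      refine hpos _ ?_
      rw [hj.r_eq]
      exact Submodule.smul_mem _ _ hj.y_mem
  · have hi := hinv i le_rfl
    have hc := (h.2 i i.lt_succ_self).2
    have hr0 : r = 0 := by
      rw [hr, hs]; exact hi.next_res_of_exhausted hβ (not_le.1 hc)
    -- At i + 1 the Lanczos vector is zero and regularity is silent; iteration i already covers the
    -- final iterate.
    have hpos := hreg' i ⟨fun k hk => h.2 k (hk.trans i.lt_succ_self), Or.inr hc⟩ hinv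
    refine ⟨by simp [hr0], ?_, by simp [hr0]; positivity, by simp [hr0]⟩
    rw [hs]
    exact hpos _ (hi.sNext_mem (MinresState.γ₂_ne_zero (not_le.1 hc)))

/-- Properties of the direction returned with type `NPC`. -/
theorem MinresStopNpc.properties (hA : ∀ x y, inner ℝ (A x) y = inner ℝ x (A y)) (hg : g ≠ 0)
    (hη : 0 ≤ η) {j : ℕ} (h : MinresStopNpc A g η j) {r : Vec d}
    (hr : r = (minresState A g j).r) :
    r ≠ 0 ∧ inner ℝ r (A r) ≤ 0 ∧ inner ℝ g r = -‖r‖ ^ 2 := by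
  rcases minresState_inv_or_just_exhausted hA hg hη j h.2 with hinv | ⟨i, rfl, hβ, hinv⟩
  · have hj := hinv j le_rfl
    rw [hr]
    refine ⟨?_, ?_, hj.inner_g_r⟩
    · rw [← norm_ne_zero_iff, hj.norm_r]; exact hj.φ_pos.ne'
    · rw [hj.r_eq, map_smul, real_inner_smul_left, inner_smul_right, hj.inner_y_map_y hA]
      have h1 : 0 ≤ (minresState A g j).c * (minresState A g j).γ₁ A := h.1.2
      have h2 := hj.φ_pos
      have : 0 ≤ (minresState A g j).φ * ((minresState A g j).φ *
        ((minresState A g j).c * (minresState A g j).γ₁ A)) := by positivity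
      linarith
  · exact absurd (minresSolTest_of_exhausted hη hβ (h.2 i i.lt_succ_self).2) h.1.1

/-- If MINRES with `η = 0` returns with type `SOL`, then `A` is positive semidefinite on an
invariant subspace that contains `g`. -/
theorem MinresStopSol.exists_invariant (hA : ∀ x y, inner ℝ (A x) y = inner ℝ x (A y))
    (hg : g ≠ 0) {j : ℕ} (h : MinresStopSol A g 0 j) :
    ∃ K : Submodule ℝ (Vec d), g ∈ K ∧ (∀ x ∈ K, A x ∈ K) ∧ ∀ x ∈ K, 0 ≤ inner ℝ x (A x) := by
  rcases minresState_inv_or_just_exhausted hA hg le_rfl j h.2 with hinv | ⟨i, rfl, hβ, hinv⟩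
  · have hj := hinv j le_rfl
    have h1 := h.1
    simp only [minresSolTest, zero_mul] at h1
    -- As φ > 0, the test with η = 0 says A y = 0. Then γ₁ = 0, and c ≠ 0 forces q = 0: the Krylov
    -- space is invariant.
    have h2 : Real.sqrt ((minresState A g j).γ₁ A ^ 2 + (minresState A g j).δNext A ^ 2) ≤ 0 := by
      by_contra hcon
      exact absurd h1 (not_le.2 (mul_pos hj.φ_pos (not_le.1 hcon)))
    have h3 := Real.sqrt_eq_zero'.1 (le_antisymm h2 (Real.sqrt_nonneg _))
    have h4 : (minresState A g j).γ₁ A = 0 := by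
      rw [← sq_eq_zero_iff]
      nlinarith [sq_nonneg ((minresState A g j).γ₁ A), sq_nonneg ((minresState A g j).δNext A)]
    have h5 : (minresState A g j).δNext A = 0 := by
      rw [← sq_eq_zero_iff]
      nlinarith [sq_nonneg ((minresState A g j).γ₁ A), sq_nonneg ((minresState A g j).δNext A)]
    have hβ : (minresState A g j).βNext A = 0 :=
      (mul_eq_zero.1 h5).resolve_left (neg_ne_zero.2 hj.c_ne)
    exact ⟨_, hj.g_mem, hj.map_mem_of_exhausted hβ, hj.psd_sup hA (by rw [h4, mul_zero])⟩
  · have hi := hinv i le_rfl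
    exact ⟨_, hi.g_mem, hi.map_mem_of_exhausted hβ,
      hi.psd_sup hA (not_le.1 (h.2 i i.lt_succ_self).2).le⟩

/-- If MINRES with `η = 0` returns with type `SOL`, then `g` is orthogonal to all eigenvectors of
`A` with negative eigenvalue. -/
theorem MinresStopSol.inner_eigenvector (hA : ∀ x y, inner ℝ (A x) y = inner ℝ x (A y))
    (hg : g ≠ 0) {j : ℕ} (h : MinresStopSol A g 0 j) {e : Vec d} {μ : ℝ} (hμ : μ < 0)
    (he : A e = μ • e) : inner ℝ e g = 0 := by
  obtain ⟨K, hgK, hmap, hpsd⟩ := h.exists_invariant hA hg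
  have hproj : ∀ x ∈ K, inner ℝ (K.starProjection e) x = inner ℝ e x := fun x hx => by
    rw [Submodule.inner_starProjection_left_eq_right, Submodule.starProjection_eq_self_iff.2 hx]
  set P := K.starProjection e with hP
  have hPK : P ∈ K := Submodule.starProjection_apply_mem K e
  -- By invariance A P ∈ K, so ⟨P, A P⟩ = ⟨e, A P⟩ = μ ⟨e, P⟩. As μ < 0, semidefiniteness on K
  -- forces P = 0.
  have h1 : inner ℝ P (A P) = μ * ‖P‖ ^ 2 := by
    rw [hproj _ (hmap _ hPK), ← hA, he, real_inner_smul_left, ← hproj _ hPK,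
      real_inner_self_eq_norm_sq]
  have h2 := hpsd P hPK
  have h3 : P = 0 := by
    rw [← norm_eq_zero, ← sq_eq_zero_iff]
    nlinarith [sq_nonneg ‖P‖]
  rw [← hproj g hgK, h3, inner_zero_left]

end MinresResults

/-! ### Taylor bounds from the Lipschitz Hessian -/

section Taylor

variable {d : ℕ} {f : Vec d → ℝ} {LH ε : ℝ}

lemma contDiff_gradient (hf : ContDiff ℝ 2 f) : ContDiff ℝ 1 (gradient f) :=
  (InnerProductSpace.toDual ℝ (Vec d)).symm.contDiff.comp (hf.fderiv_right (by norm_num))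

lemma hasFDerivAt_gradient (hf : ContDiff ℝ 2 f) (x : Vec d) :
    HasFDerivAt (gradient f) (hessian f x) x :=
  ((contDiff_gradient hf).differentiable one_ne_zero x).hasFDerivAt

lemma hasGradientAt_gradient (hf : ContDiff ℝ 2 f) (x : Vec d) :
    HasGradientAt f (gradient f x) x :=
  (hf.differentiable two_ne_zero x).hasGradientAt

lemma inner_hessian (hf : ContDiff ℝ 2 f) (x u v : Vec d) :
    inner ℝ (hessian f x u) v = fderiv ℝ (fderiv ℝ f) x u v := by
  have h1 : HasFDerivAt (fderiv ℝ f) (fderiv ℝ (fderiv ℝ f) x) x :=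
    ((hf.fderiv_right (m := 1) (by norm_num)).differentiable one_ne_zero x).hasFDerivAt
  have h2 : HasFDerivAt (fun z => inner ℝ (gradient f z) v)
      ((innerSL ℝ v).comp (hessian f x)) x := by
    have := (innerSL ℝ v).hasFDerivAt.comp x (hasFDerivAt_gradient hf x)
    have h4 : (fun z => inner ℝ (gradient f z) v) = innerSL ℝ v ∘ gradient f := by
      ext z
      simp
    rw [h4]
    exact this
  have h3 : HasFDerivAt (fun z => fderiv ℝ f z v)
      ((ContinuousLinearMap.apply ℝ ℝ v).comp (fderiv ℝ (fderiv ℝ f) x)) x :=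
    (ContinuousLinearMap.apply ℝ ℝ v).hasFDerivAt.comp x h1
  have h4 : (fun z => inner ℝ (gradient f z) v) = fun z => fderiv ℝ f z v := by
    ext z
    rw [gradient, InnerProductSpace.toDual_symm_apply]
  rw [h4] at h2
  have h5 := DFunLike.congr_fun (h2.unique h3) u
  simp only [ContinuousLinearMap.comp_apply, innerSL_apply_apply,
    ContinuousLinearMap.apply_apply] at h5
  rw [real_inner_comm, h5]

lemma hessian_symm (hf : ContDiff ℝ 2 f) (x u v : Vec d) :
    inner ℝ (hessian f x u) v = inner ℝ u (hessian f x v) := by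
  have h1 : IsSymmSndFDerivAt ℝ f x := hf.contDiffAt.isSymmSndFDerivAt (by simp)
  rw [real_inner_comm (hessian f x v) u, inner_hessian hf, inner_hessian hf, h1 u v]

variable (hf : ContDiff ℝ 2 f)
  (hLH : ∀ x y, ‖NewtonMR.hessian f x - NewtonMR.hessian f y‖ ≤ LH * ‖x - y‖)

include hf hLH in
-- Along s ↦ x + s e the derivative of the remainder is (H(x + s e) - H(x)) e, of norm at most LH s
-- ‖e‖²; the mean value inequality integrates this bound.
lemma norm_gradient_add_sub_le (x e : Vec d) {t : ℝ} (ht : 0 ≤ t) :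
    ‖gradient f (x + t • e) - gradient f x - t • hessian f x e‖ ≤ LH * t ^ 2 / 2 * ‖e‖ ^ 2 := by
  have hline : ∀ s : ℝ, HasDerivAt (fun s : ℝ => x + s • e) e s := fun s => by
    simpa using ((hasDerivAt_id s).smul_const e).const_add x
  have hder : ∀ s : ℝ, HasDerivAt
      (fun s : ℝ => gradient f (x + s • e) - gradient f x - s • hessian f x e)
      (hessian f (x + s • e) e - hessian f x e) s := fun s => by
    have h1 := (hasFDerivAt_gradient hf (x + s • e)).comp_hasDerivAt s (hline s)
    have h2 : HasDerivAt (fun s : ℝ => s • hessian f x e) (hessian f x e) s := by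
      simpa using (hasDerivAt_id s).smul_const (hessian f x e)
    exact (h1.sub_const _).sub h2
  refine image_norm_le_of_norm_deriv_right_le_deriv_boundary (a := 0) (b := t)
    (f := fun s : ℝ => gradient f (x + s • e) - gradient f x - s • hessian f x e)
    (f' := fun s => hessian f (x + s • e) e - hessian f x e)
    (B := fun s => LH * s ^ 2 / 2 * ‖e‖ ^ 2) (B' := fun s => LH * s * ‖e‖ ^ 2)
    (fun s _ => (hder s).continuousAt.continuousWithinAt)
    (fun s _ => (hder s).hasDerivWithinAt) (by simp) (fun s => ?_) (fun s hs => ?_) ⟨ht, le_rfl⟩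
  · have := (((hasDerivAt_id s).pow 2).const_mul LH).div_const 2 |>.mul_const (‖e‖ ^ 2)
    refine this.congr_deriv ?_
    simp only [id]
    push_cast
    ring
  · rw [← sub_apply]
    refine (ContinuousLinearMap.le_opNorm _ _).trans ?_
    have h1 := hLH (x + s • e) x
    rw [add_sub_cancel_left, norm_smul, Real.norm_of_nonneg hs.1] at h1
    calc _ ≤ LH * (s * ‖e‖) * ‖e‖ := by gcongr
      _ = _ := by ring

include hf hLH in
lemma abs_sub_taylor_le (x e : Vec d) {t : ℝ} (ht : 0 ≤ t) :
    |f (x + t • e) - f x - t * inner ℝ (gradient f x) e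
      - t ^ 2 / 2 * inner ℝ (hessian f x e) e| ≤ LH * t ^ 3 / 6 * ‖e‖ ^ 3 := by
  have hline : ∀ s : ℝ, HasDerivAt (fun s : ℝ => x + s • e) e s := fun s => by
    simpa using ((hasDerivAt_id s).smul_const e).const_add x
  have hder : ∀ s : ℝ, HasDerivAt
      (fun s : ℝ => f (x + s • e) - f x - s * inner ℝ (gradient f x) e
        - s ^ 2 / 2 * inner ℝ (hessian f x e) e)
      (inner ℝ (gradient f (x + s • e) - gradient f x - s • hessian f x e) e) s := fun s => by
    have h1 := (hasGradientAt_gradient hf (x + s • e)).hasFDerivAt.comp_hasDerivAt s (hline s)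
    have h2 := (hasDerivAt_id s).mul_const (inner ℝ (gradient f x) e)
    have h3 := (((hasDerivAt_id s).pow 2).div_const 2).mul_const (inner ℝ (hessian f x e) e)
    refine (((h1.sub_const (f x)).sub h2).sub h3).congr_deriv ?_
    simp [inner_sub_left, real_inner_smul_left]
  rw [← Real.norm_eq_abs]
  refine image_norm_le_of_norm_deriv_right_le_deriv_boundary (a := 0) (b := t)
    (f := fun s : ℝ => f (x + s • e) - f x - s * inner ℝ (gradient f x) e
        - s ^ 2 / 2 * inner ℝ (hessian f x e) e)
    (f' := fun s => inner ℝ (gradient f (x + s • e) - gradient f x - s • hessian f x e) e)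
    (B := fun s => LH * s ^ 3 / 6 * ‖e‖ ^ 3) (B' := fun s => LH * s ^ 2 / 2 * ‖e‖ ^ 3)
    (fun s _ => (hder s).continuousAt.continuousWithinAt)
    (fun s _ => (hder s).hasDerivWithinAt) (by simp) (fun s => ?_) (fun s hs => ?_) ⟨ht, le_rfl⟩
  · have := (((hasDerivAt_id s).pow 3).const_mul LH).div_const 6 |>.mul_const (‖e‖ ^ 3)
    refine this.congr_deriv ?_
    simp only [id]
    push_cast
    ring
  · refine (norm_inner_le_norm _ _).trans ?_
    have h1 := norm_gradient_add_sub_le hf hLH x e hs.1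
    calc _ ≤ LH * s ^ 2 / 2 * ‖e‖ ^ 2 * ‖e‖ := by gcongr
      _ = _ := by ring

include hf hLH in
/-- The upper bound on `f` along a direction, in terms of an inexact Hessian `hessian f x + E`. -/
lemma le_inexact_taylor (x e : Vec d) {E : Vec d →L[ℝ] Vec d} (hE : ‖E‖ ≤ ε) {t : ℝ} (ht : 0 ≤ t) :
    f (x + t • e) ≤ f x + t * inner ℝ (gradient f x) e
      + t ^ 2 / 2 * (inner ℝ e ((hessian f x + E) e) + ε * ‖e‖ ^ 2) + LH * t ^ 3 / 6 * ‖e‖ ^ 3 := by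
  have h1 := (abs_le.1 (abs_sub_taylor_le hf hLH x e ht)).2
  have h2 : |inner ℝ e (E e)| ≤ ε * ‖e‖ ^ 2 := by
    refine (abs_real_inner_le_norm _ _).trans ?_
    have := E.le_of_opNorm_le hE e
    calc _ ≤ ‖e‖ * (ε * ‖e‖) := by gcongr
      _ = _ := by ring
  have h3 := (abs_le.1 h2).1
  rw [real_inner_comm e (hessian f x e)] at h1
  rw [add_apply, inner_add_right]
  have h4 : 0 ≤ t ^ 2 / 2 * (inner ℝ e (E e) + ε * ‖e‖ ^ 2) :=
    mul_nonneg (by positivity) (by linarith)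
  linarith

end Taylor

/-! ### Existence of the greatest acceptable step -/

section LineSearch

variable {d : ℕ}

lemma lineSearchStep_eq {x e : Vec d} {S : Set ℝ} {α : ℝ} (h : IsGreatest S α) :
    lineSearchStep x e S = Outcome.moved (x + α • e) := by
  have hex : ∃ α, IsGreatest S α := ⟨α, h⟩
  rw [lineSearchStep, dif_pos hex, (Classical.choose_spec hex).unique h]

/-- A set of positive solutions of a continuous inequality has a greatest element as soon as it is
nonempty and bounded above. -/
lemma exists_isGreatest_of_continuous {h : ℝ → ℝ} (hh : Continuous h) {α₀ b : ℝ} (hα₀ : 0 < α₀)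
    (hα₀h : h α₀ ≤ 0) (hb : ∀ α, 0 < α → h α ≤ 0 → α ≤ b) :
    ∃ α, IsGreatest {α | 0 < α ∧ h α ≤ 0} α ∧ α₀ ≤ α := by
  have hcl : IsCompact (Set.Icc α₀ b ∩ {α | h α ≤ 0}) :=
    isCompact_Icc.inter_right (isClosed_le hh continuous_const)
  obtain ⟨α, hα⟩ := hcl.exists_isGreatest ⟨α₀, ⟨le_rfl, hb _ hα₀ hα₀h⟩, hα₀h⟩
  refine ⟨α, ⟨⟨hα₀.trans_le hα.1.1.1, hα.1.2⟩, fun β hβ => ?_⟩, hα.1.1.1⟩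
  rcases le_total α₀ β with h1 | h1
  · exact hα.2 ⟨⟨h1, hb β hβ.1 hβ.2⟩, hβ.2⟩
  · exact h1.trans hα.1.1.1

end LineSearch

/-! ### Decrease achieved by each type of direction -/

section StepSizes

variable {d : ℕ} {f : Vec d → ℝ} {LH Lg ε εg εH σ ρS ρN θ η ω fstar : ℝ} {x e r : Vec d}
  {E : Vec d →L[ℝ] Vec d}

/-- The line search along a direction of type `SOL`. -/
theorem exists_isGreatest_sol (hf : ContDiff ℝ 2 f) (hLH_pos : 0 < LH)
    (hLH : ∀ x y, ‖hessian f x - hessian f y‖ ≤ LH * ‖x - y‖) (hE : ‖E‖ ≤ ε)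
    (hσ : 0 < σ) (hρS : 0 < ρS) (hρS1 : ρS < 1 / 2) (hε2 : ε ≤ σ * (1 - 2 * ρS) / 2)
    (hge : inner ℝ (gradient f x) e ≤ -inner ℝ e ((hessian f x + E) e))
    (hcurv : σ * ‖e‖ ^ 2 ≤ inner ℝ e ((hessian f x + E) e)) :
    ∃ α, IsGreatest ({α | 0 < α ∧ f (x + α • e) ≤ f x + ρS * α * inner ℝ (gradient f x) e}
      ∩ Set.Iic 1) α ∧ (α = 1 ∨ c₁ σ ρS LH ≤ f x - f (x + α • e)) := by
  set G := inner ℝ (gradient f x) e with hG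
  set Q := inner ℝ e ((hessian f x + E) e) with hQ
  set n := ‖e‖ with hn
  have hn0 : 0 ≤ n := norm_nonneg e
  have hQ0 : 0 ≤ Q := le_trans (by positivity) hcurv
  -- Chosen so that the noise term and the cubic term each use at most half of the margin α (1/2 -
  -- ρS) σ ‖e‖² left by the Armijo condition.
  set κ := 3 * (1 - 2 * ρS) * σ / (2 * LH) with hκ
  have hκpos : 0 < κ := div_pos (mul_pos (mul_pos three_pos (by linarith)) hσ) (by positivity)
  have hκLH : LH * κ = 3 * (1 - 2 * ρS) * σ / 2 := by rw [hκ]; field_simp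
  have key : ∀ α, 0 < α → α ≤ 1 → α ^ 2 * n ≤ κ → f (x + α • e) ≤ f x + ρS * α * G := by
    intro α hα hα1 hακ
    have h1 := le_inexact_taylor hf hLH x e hE hα.le
    rw [← hG, ← hQ, ← hn] at h1
    have h2 : α * (1 - ρS) * G ≤ α * (1 - ρS) * (-Q) :=
      mul_le_mul_of_nonneg_left hge (mul_nonneg hα.le (by linarith))
    have h3 : α ^ 2 / 2 * (Q + ε * n ^ 2) ≤ α / 2 * (Q + σ * (1 - 2 * ρS) / 2 * n ^ 2) := by
      have : α ^ 2 ≤ α := by nlinarith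
      have hpos : 0 ≤ σ * (1 - 2 * ρS) / 2 :=
        div_nonneg (mul_nonneg hσ.le (by linarith)) two_pos.le
      have hε0 : 0 ≤ ε := (norm_nonneg _).trans hE
      have hpos' : 0 ≤ Q + ε * n ^ 2 := by positivity
      gcongr
    have h4 : LH * α ^ 3 / 6 * n ^ 3 ≤ α * n ^ 2 / 6 * (3 * (1 - 2 * ρS) * σ / 2) := by
      rw [← hκLH]
      calc LH * α ^ 3 / 6 * n ^ 3 = α * n ^ 2 / 6 * (LH * (α ^ 2 * n)) := by ring
        _ ≤ _ := by gcongr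
    have h5 : α * (1 / 2 - ρS) * (σ * n ^ 2) ≤ α * (1 / 2 - ρS) * Q :=
      mul_le_mul_of_nonneg_left hcurv (mul_nonneg hα.le (by linarith))
    linarith
  rcases le_or_gt n κ with hnκ | hnκ
  · exact ⟨1, ⟨⟨⟨one_pos, key 1 one_pos le_rfl (by simpa using hnκ)⟩, Set.mem_Iic.2 le_rfl⟩,
      fun β hβ => hβ.2⟩, Or.inl rfl⟩
  · have hnpos : 0 < n := hκpos.trans hnκ
    have hq0 : 0 < κ / n := by positivity
    have hq1 : κ / n < 1 := (div_lt_one hnpos).2 hnκ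
    -- The longest step with α² n ≤ κ. It is at most 1, hence at least its square κ / n, which gives
    -- α n² ≥ κ n > κ².
    set α₀ := Real.sqrt (κ / n) with hα₀
    have hα₀pos : 0 < α₀ := Real.sqrt_pos.2 hq0
    have hα₀sq : α₀ ^ 2 = κ / n := Real.sq_sqrt hq0.le
    have hα₀1 : α₀ ≤ 1 := by nlinarith
    have hα₀ge : κ / n ≤ α₀ := by nlinarith
    have hα₀f := key α₀ hα₀pos hα₀1 (by rw [hα₀sq]; field_simp; exact le_rfl)
    -- The maximum encodes the cap α ≤ 1 in a single continuous inequality.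
    have hcont : Continuous fun α : ℝ => max (f (x + α • e) - (f x + ρS * α * G)) (α - 1) := by
      have := hf.continuous
      fun_prop
    obtain ⟨α, hα, hαge⟩ := exists_isGreatest_of_continuous (b := 1) hcont hα₀pos
      (max_le (by linarith) (by linarith)) fun α _ h => by linarith [(max_le_iff.1 h).2]
    have hset : {α : ℝ | 0 < α ∧ max (f (x + α • e) - (f x + ρS * α * G)) (α - 1) ≤ 0}
        = {α | 0 < α ∧ f (x + α • e) ≤ f x + ρS * α * G} ∩ Set.Iic 1 := by
      ext α
      simp only [max_le_iff, sub_nonpos, Set.mem_ofPred_eq, Set.mem_inter_iff, Set.mem_Iic]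
      tauto
    rw [hset] at hα
    refine ⟨α, hα, Or.inr ?_⟩
    have h1 := hα.1.1.2
    have h2 : ρS * α * (σ * n ^ 2) ≤ ρS * α * (-G) :=
      mul_le_mul_of_nonneg_left (by linarith) (mul_nonneg hρS.le hα.1.1.1.le)
    have h3 : κ * n ≤ α * n ^ 2 := by
      calc κ * n = κ / n * n ^ 2 := by field_simp
        _ ≤ α * n ^ 2 := by gcongr; exact hα₀ge.trans hαge
    have h4 : κ ^ 2 ≤ α * n ^ 2 := by nlinarith
    calc c₁ σ ρS LH = ρS * σ * κ ^ 2 := rfl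
      _ ≤ ρS * σ * (α * n ^ 2) := by gcongr
      _ ≤ f x - f (x + α • e) := by linarith

lemma c₀_pos (hσ : 0 < σ) (hθ : 0 < θ) (hLg : 0 ≤ Lg) : 0 < c₀ σ θ Lg LH := by
  rw [c₀]; positivity

/-- `c₀` is the positive root of the quadratic that governs the length of a full step, in
rationalised form. -/
lemma c₀_root (hσ : 0 < σ) (hθ : 0 < θ) (hLg : 0 ≤ Lg) (hLH_pos : 0 < LH) :
    σ * LH / 2 * c₀ σ θ Lg LH ^ 2 + (1 + θ * Lg) * c₀ σ θ Lg LH = σ := by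
  rw [c₀]
  set B := 1 + θ * Lg
  have hB : 0 < B := by positivity
  set R := Real.sqrt (B ^ 2 + 2 * σ ^ 2 * LH)
  have hR : R ^ 2 = B ^ 2 + 2 * σ ^ 2 * LH := Real.sq_sqrt (by positivity)
  have hBR : 0 < B + R := by positivity
  field_simp
  nlinarith

/-- A long step is necessary if the next gradient is to be large. -/
theorem c₀_mul_sqrt_le_norm (hf : ContDiff ℝ 2 f) (hLg : ‖hessian f x‖ ≤ Lg) (hLH_pos : 0 < LH)
    (hLH : ∀ x y, ‖hessian f x - hessian f y‖ ≤ LH * ‖x - y‖) (hE : ‖E‖ ≤ ε) (hεg : 0 < εg)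
    (hσ : 0 < σ) (hθ : 0 < θ) (hη : η = θ * Real.sqrt εg) (hε1 : ε ≤ Real.sqrt εg / (η + σ))
    (hr : r = -(hessian f x + E) e - gradient f x)
    (hres : ‖(hessian f x + E) r‖ ≤ η * ‖(hessian f x + E) e‖)
    (hcurv : σ * ‖r‖ ^ 2 ≤ inner ℝ r ((hessian f x + E) r))
    (hlarge : εg < ‖gradient f (x + e)‖) : c₀ σ θ Lg LH * Real.sqrt εg ≤ ‖e‖ := by
  set q := Real.sqrt εg with hq
  have hq0 : 0 < q := Real.sqrt_pos.2 hεg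
  have hq2 : q ^ 2 = εg := Real.sq_sqrt hεg.le
  have hη0 : 0 < η := by rw [hη]; positivity
  have hLg0 : 0 ≤ Lg := (norm_nonneg _).trans hLg
  have hε0 : 0 ≤ ε := (norm_nonneg _).trans hE
  rw [le_div_iff₀ (by positivity)] at hε1
  set n := ‖e‖ with hn
  have hn0 : 0 ≤ n := norm_nonneg e
  have h1 : σ * ‖r‖ ≤ ‖(hessian f x + E) r‖ := by
    rcases eq_or_lt_of_le (norm_nonneg r) with h | h
    · rw [← h, mul_zero]; exact norm_nonneg _
    · have := hcurv.trans (real_inner_le_norm _ _)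
      exact le_of_mul_le_mul_left (by linarith) h
  have h2 : ‖(hessian f x + E) e‖ ≤ (Lg + ε) * n :=
    ContinuousLinearMap.le_of_opNorm_le _ ((norm_add_le _ _).trans (add_le_add hLg hE)) e
  have h3 : ‖E e‖ ≤ ε * n := E.le_of_opNorm_le hE e
  have h4 := norm_gradient_add_sub_le hf hLH x e zero_le_one
  simp only [one_smul, one_pow, mul_one] at h4
  have h5 : gradient f (x + e) =
      (gradient f (x + e) - gradient f x - hessian f x e) - r - E e := by
    rw [hr, add_apply]; abel
  have h6 : ‖gradient f (x + e)‖ ≤ LH / 2 * n ^ 2 + ‖r‖ + ε * n := by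
    rw [h5]
    refine (norm_sub_le _ _).trans (add_le_add ((norm_sub_le _ _).trans ?_) h3)
    exact add_le_add h4 le_rfl
  have h7 : σ * ‖r‖ ≤ η * ((Lg + ε) * n) :=
    h1.trans (hres.trans (mul_le_mul_of_nonneg_left h2 hη0.le))
  -- The next gradient is Taylor remainder minus residual minus noise. Times σ, the two noise
  -- contributions add up to ε (η + σ) n ≤ q n, which is the purpose of the first bound on ε.
  have h8 : σ * q ^ 2 < σ * LH / 2 * n ^ 2 + q * (1 + θ * Lg) * n := by
    have h9 : σ * εg < σ * (LH / 2 * n ^ 2 + ‖r‖ + ε * n) :=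
      mul_lt_mul_of_pos_left (hlarge.trans_le h6) hσ
    have h10 : ε * (η + σ) * n ≤ q * n := mul_le_mul_of_nonneg_right hε1 hn0
    have h11 : η * Lg * n = q * (θ * Lg) * n := by rw [hη]; ring
    rw [hq2]
    linarith
  by_contra hcon
  push Not at hcon
  have h12 := c₀_root hσ hθ hLg0 hLH_pos
  set c := c₀ σ θ Lg LH
  have h13 : σ * LH / 2 * n ^ 2 + q * (1 + θ * Lg) * n
      ≤ σ * LH / 2 * (c * q) ^ 2 + q * (1 + θ * Lg) * (c * q) := by
    gcongr
  have h14 : σ * LH / 2 * (c * q) ^ 2 + q * (1 + θ * Lg) * (c * q) = q ^ 2 * σ := by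
    linear_combination q ^ 2 * h12
  linarith

/-- The line search along a direction of nonpositive curvature that is a descent direction. -/
theorem exists_isGreatest_npc (hf : ContDiff ℝ 2 f) (hmin : ∀ y, fstar ≤ f y) (hLH_pos : 0 < LH)
    (hLH : ∀ x y, ‖hessian f x - hessian f y‖ ≤ LH * ‖x - y‖) (hE : ‖E‖ ≤ ε) (hε_pos : 0 < ε)
    (hρN : 0 < ρN) (hρN1 : ρN < 1) (hr : r ≠ 0)
    (hgr : inner ℝ (gradient f x) r = -‖r‖ ^ 2)
    (hcurv : inner ℝ r ((hessian f x + E) r) ≤ 0) :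
    ∃ α, IsGreatest {α | 0 < α ∧ f (x + α • r) ≤ f x + ρN * α * inner ℝ (gradient f x) r} α ∧
      ρN * (min ((1 - ρN) / ε) (Real.sqrt (3 * (1 - ρN) / (LH * ‖r‖))) * ‖r‖ ^ 2)
        ≤ f x - f (x + α • r) := by
  rw [hgr]
  set n := ‖r‖ with hn
  have hn0 : 0 < n := norm_pos_iff.2 hr
  have hρ : 0 < 1 - ρN := by linarith
  have hq0 : 0 < 3 * (1 - ρN) / (LH * n) := by positivity
  set a := (1 - ρN) / ε with ha
  set b := Real.sqrt (3 * (1 - ρN) / (LH * n)) with hb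
  have ha0 : 0 < a := by positivity
  have hb0 : 0 < b := Real.sqrt_pos.2 hq0
  have hb2 : b ^ 2 * (LH * n) = 3 * (1 - ρN) := by
    rw [hb, Real.sq_sqrt hq0.le]; field_simp
  have haε : a * ε = 1 - ρN := by rw [ha]; field_simp
  -- Each entry of the minimum keeps one error term, noise or cubic, below half of (1 - ρN) α ‖r‖².
  set α₀ := min a b with hα₀
  have hα₀pos : 0 < α₀ := lt_min ha0 hb0
  have hα₀f : f (x + α₀ • r) ≤ f x + ρN * α₀ * (-n ^ 2) := by
    have h1 := le_inexact_taylor hf hLH x r hE hα₀pos.le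
    rw [hgr, ← hn] at h1
    have h2 : α₀ * ε ≤ 1 - ρN := by
      rw [← haε]; exact mul_le_mul_of_nonneg_right (min_le_left _ _) hε_pos.le
    have h3 : α₀ ^ 2 * (LH * n) ≤ 3 * (1 - ρN) := by
      rw [← hb2]
      have : α₀ ≤ b := min_le_right _ _
      gcongr
    have h4 : α₀ ^ 2 / 2 * inner ℝ r ((hessian f x + E) r) ≤ 0 :=
      mul_nonpos_of_nonneg_of_nonpos (by positivity) hcurv
    have h5 : α₀ * n ^ 2 / 2 * (α₀ * ε) ≤ α₀ * n ^ 2 / 2 * (1 - ρN) := by gcongr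
    have h6 : α₀ * n ^ 2 / 6 * (α₀ ^ 2 * (LH * n)) ≤ α₀ * n ^ 2 / 6 * (3 * (1 - ρN)) := by
      gcongr
    linarith
  have hcont : Continuous fun α : ℝ => f (x + α • r) - (f x + ρN * α * (-n ^ 2)) := by
    have := hf.continuous
    fun_prop
  obtain ⟨α, hα, hαge⟩ := exists_isGreatest_of_continuous (b := (f x - fstar) / (ρN * n ^ 2)) hcont
    hα₀pos (by linarith) fun α _ h => by
      rw [le_div_iff₀ (by positivity)]
      linarith [hmin (x + α • r)]
  simp only [sub_nonpos] at hα
  refine ⟨α, hα, ?_⟩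
  have h1 := hα.1.2
  have h2 : ρN * (α₀ * n ^ 2) ≤ ρN * (α * n ^ 2) := by gcongr
  linarith

/-- The decrease along a direction of nonpositive curvature that is a descent direction. -/
theorem c₃_mul_le (hLH_pos : 0 < LH) (hε_pos : 0 < ε) (hεg : 0 < εg) (hρN : 0 < ρN)
    (hρN1 : ρN < 1) (hσ : 0 < σ) (hη0 : 0 < η) (hω : 0 < ω)
    (hε1 : ε ≤ Real.sqrt εg / (η + σ)) (hr : ω * εg ≤ ‖r‖) :
    c₃ σ ρN ω LH * εg ^ (3 / 2 : ℝ)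
      ≤ ρN * (min ((1 - ρN) / ε) (Real.sqrt (3 * (1 - ρN) / (LH * ‖r‖))) * ‖r‖ ^ 2) := by
  set n := ‖r‖ with hn
  have hn0 : 0 < n := (by positivity : 0 < ω * εg).trans_le hr
  have hρ : 0 < 1 - ρN := by linarith
  have hpow : ∀ t : ℝ, 0 ≤ t → t ^ (3 / 2 : ℝ) = Real.sqrt t * t := fun t ht => by
    rcases eq_or_lt_of_le ht with rfl | ht
    · rw [Real.zero_rpow (by norm_num)]; simp
    · rw [Real.sqrt_eq_rpow, ← Real.rpow_add_one ht.ne']; norm_num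
  rw [c₃, mul_assoc]
  refine mul_le_mul_of_nonneg_left ?_ hρN.le
  rw [min_mul_of_nonneg _ _ (by positivity), min_mul_of_nonneg _ _ (by positivity)]
  refine le_min ((min_le_right _ _).trans ?_) ((min_le_left _ _).trans ?_)
  · have h1 : σ * ε ≤ Real.sqrt εg := by
      rw [le_div_iff₀ (by positivity)] at hε1
      -- Dropping the positive product ε η from ε (η + σ) ≤ √εg.
      nlinarith [mul_pos hε_pos hη0]
    have h2 : σ * Real.sqrt εg ≤ εg / ε := by
      rw [le_div_iff₀ hε_pos]
      calc σ * Real.sqrt εg * ε = Real.sqrt εg * (σ * ε) := by ring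
        _ ≤ Real.sqrt εg * Real.sqrt εg := by gcongr
        _ = εg := Real.mul_self_sqrt hεg.le
    calc (1 - ρN) * σ * ω ^ 2 * εg ^ (3 / 2 : ℝ)
        = (1 - ρN) * ω ^ 2 * εg * (σ * Real.sqrt εg) := by rw [hpow _ hεg.le]; ring
      _ ≤ (1 - ρN) * ω ^ 2 * εg * (εg / ε) := by gcongr
      _ = (1 - ρN) / ε * (ω * εg) ^ 2 := by ring
      _ ≤ (1 - ρN) / ε * n ^ 2 := by gcongr
  · have h1 : Real.sqrt (3 * (1 - ρN) / (LH * n)) * n ^ 2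
        = Real.sqrt (3 * (1 - ρN) / LH) * (Real.sqrt n * n) := by
      rw [← div_div, Real.sqrt_div (by positivity)]
      have h2 : Real.sqrt n * Real.sqrt n = n := Real.mul_self_sqrt hn0.le
      have h3 : 0 < Real.sqrt n := Real.sqrt_pos.2 hn0
      field_simp
      rw [sq, h2]
    rw [h1, ← hpow _ hn0.le]
    calc ω ^ (3 / 2 : ℝ) * Real.sqrt (3 * (1 - ρN) / LH) * εg ^ (3 / 2 : ℝ)
        = Real.sqrt (3 * (1 - ρN) / LH) * (ω * εg) ^ (3 / 2 : ℝ) := by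
          rw [Real.mul_rpow hω.le hεg.le]; ring
      _ ≤ _ := by gcongr

/-- The line search along a unit direction of sufficiently negative curvature. -/
theorem exists_isGreatest_curvature (hf : ContDiff ℝ 2 f) (hmin : ∀ y, fstar ≤ f y)
    (hLH_pos : 0 < LH) (hLH : ∀ x y, ‖hessian f x - hessian f y‖ ≤ LH * ‖x - y‖) (hE : ‖E‖ ≤ ε)
    (hεH : 0 < εH) (hρN : 0 < ρN) (hρN1 : ρN < 1) (hε4 : ε ≤ εH / 10)
    (hε5 : ε ≤ (1 - ρN) * εH / (2 * (3 - ρN))) (he : ‖e‖ = 1)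
    (hge : inner ℝ (gradient f x) e ≤ 0)
    (hcurv : inner ℝ e ((hessian f x + E) e) ≤ -(1 / 2 * (εH - ε))) :
    ∃ α, IsGreatest {α | 0 < α ∧
        f (x + α • e) ≤ f x + 1 / 2 * ρN * α ^ 2 * inner ℝ e ((hessian f x + E) e)} α ∧
      c₄ ρN LH * εH ^ 3 ≤ f x - f (x + α • e) := by
  set Q := inner ℝ e ((hessian f x + E) e) with hQ
  have hρ : 0 < 1 - ρN := by linarith
  -- With this length the cubic term uses half of (1 - ρN) εH / 2; the last bound on ε is exactly
  -- what the remaining half has to absorb.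
  set α₀ := 3 * (1 - ρN) * εH / (4 * LH) with hα₀
  have hα₀pos : 0 < α₀ := by positivity
  have hα₀LH : LH * α₀ = 3 * (1 - ρN) * εH / 4 := by rw [hα₀]; field_simp
  have hQ9 : Q ≤ -(9 / 20 * εH) := by linarith
  have hα₀f : f (x + α₀ • e) ≤ f x + 1 / 2 * ρN * α₀ ^ 2 * Q := by
    have h1 := le_inexact_taylor hf hLH x e hE hα₀pos.le
    rw [he, ← hQ] at h1
    have h2 : α₀ * inner ℝ (gradient f x) e ≤ 0 :=
      mul_nonpos_of_nonneg_of_nonpos hα₀pos.le hge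
    rw [le_div_iff₀ (by linarith)] at hε5
    have h3 : (1 - ρN) * Q + ε + LH * α₀ / 3 ≤ 0 := by
      rw [hα₀LH]
      have : (1 - ρN) * Q ≤ (1 - ρN) * -(1 / 2 * (εH - ε)) :=
        mul_le_mul_of_nonneg_left hcurv hρ.le
      linarith
    have h4 : α₀ ^ 2 / 2 * ((1 - ρN) * Q + ε + LH * α₀ / 3) ≤ 0 :=
      mul_nonpos_of_nonneg_of_nonpos (by positivity) h3
    linarith
  have hcont : Continuous fun α : ℝ => f (x + α • e) - (f x + 1 / 2 * ρN * α ^ 2 * Q) := by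
    have := hf.continuous
    fun_prop
  have hκ : 0 < 1 / 2 * ρN * -Q := mul_pos (by positivity) (by nlinarith)
  obtain ⟨α, hα, hαge⟩ := exists_isGreatest_of_continuous
    (b := (f x - fstar) / (1 / 2 * ρN * -Q) + 1) hcont
    hα₀pos (by linarith) fun α _ h => by
      -- The condition bounds α² only; this converts it into a bound on α without a square root.
      have h1 : α - 1 ≤ α ^ 2 := by nlinarith [sq_nonneg (α - 1 / 2)]
      have h2 : α - 1 ≤ (f x - fstar) / (1 / 2 * ρN * -Q) := by
        rw [le_div_iff₀ hκ]
        have := mul_le_mul_of_nonneg_right h1 hκ.le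
        linarith [hmin (x + α • e)]
      linarith
  simp only [sub_nonpos] at hα
  refine ⟨α, hα, ?_⟩
  have h1 := hα.1.2
  have h2 : 1 / 2 * ρN * α₀ ^ 2 * (9 / 20 * εH) ≤ 1 / 2 * ρN * α ^ 2 * -Q := by
    gcongr
    linarith
  have h3 : c₄ ρN LH * εH ^ 3 ≤ 1 / 2 * ρN * α₀ ^ 2 * (9 / 20 * εH) := by
    have h4 : 1 / 2 * ρN * α₀ ^ 2 * (9 / 20 * εH)
        = 81 / 640 * (ρN * (1 - ρN) ^ 2 * εH ^ 3 / LH ^ 2) := by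
      rw [hα₀]; field_simp; ring
    have h5 : c₄ ρN LH * εH ^ 3 = 9 / 128 * (ρN * (1 - ρN) ^ 2 * εH ^ 3 / LH ^ 2) := by
      rw [c₄]; field_simp; ring
    rw [h4, h5]
    exact mul_le_mul_of_nonneg_right (by norm_num) (by positivity)
  linarith

end StepSizes

/-- The standing assumptions on the problem and its parameters. -/
structure Problem.Valid {d : ℕ} (p : Problem d) (E : Vec d → Vec d →L[ℝ] Vec d)
    (Lg LH σ θ ω fstar : ℝ) : Prop where
  contDiff : ContDiff ℝ 2 p.f
  hessian_le : ∀ x, ‖hessian p.f x‖ ≤ Lg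
  LH_pos : 0 < LH
  lipschitz : ∀ x y, ‖hessian p.f x - hessian p.f y‖ ≤ LH * ‖x - y‖
  fstar_le : ∀ x, fstar ≤ p.f x
  Hbar_eq : ∀ x, p.Hbar x = hessian p.f x + E x
  E_meas : ∀ v, Measurable fun x => E x v
  E_symm : ∀ x, IsSelfAdjoint (E x)
  ε_pos : 0 < p.ε
  E_le : ∀ x, ‖E x‖ ≤ p.ε
  εg_pos : 0 < p.εg
  εg_le : p.εg ≤ 1
  εH_pos : 0 < p.εH
  ρS_pos : 0 < p.ρS
  ρS_lt : p.ρS < 1 / 2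
  ρN_pos : 0 < p.ρN
  ρN_lt : p.ρN < 1
  θ_pos : 0 < θ
  η_eq : p.η = θ * Real.sqrt p.εg
  σ_pos : 0 < σ
  krylovRegular : KrylovRegular p.f p.Hbar p.η σ
  ε_le₁ : p.ε ≤ Real.sqrt p.εg / (p.η + σ)
  ε_le₂ : p.ε ≤ σ * (1 - 2 * p.ρS) / 2
  ε_le₄ : p.ε ≤ p.εH / 10
  ε_le₅ : p.ε ≤ (1 - p.ρN) * p.εH / (2 * (3 - p.ρN))
  ω_pos : 0 < ω

/-! ### One pass through the main loop -/

section Step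

variable {d : ℕ} {p : Problem d} {E : Vec d → Vec d →L[ℝ] Vec d} {Lg LH σ θ ω fstar : ℝ}

/-- The least value of the constants in the decrease of `f`. -/
noncomputable def cMin (σ ρS ρN θ ω Lg LH : ℝ) : ℝ :=
  min (min (2 * c₁ σ ρS LH) (2 * c₂ σ ρS θ Lg LH)) (min (2 * c₃ σ ρN ω LH) (c₄ ρN LH))

/-- The decrease of `f` that is achieved on average by two successive steps. -/
noncomputable def Problem.decrease (p : Problem d) (σ θ ω Lg LH : ℝ) : ℝ :=
  cMin σ p.ρS p.ρN θ ω Lg LH / max (p.εg ^ (-(3 / 2) : ℝ)) (p.εH ^ (-3 : ℝ))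

namespace Problem.Valid

lemma Lg_nonneg (h : p.Valid E Lg LH σ θ ω fstar) : 0 ≤ Lg :=
  (norm_nonneg _).trans (h.hessian_le 0)

lemma η_pos (h : p.Valid E Lg LH σ θ ω fstar) : 0 < p.η := by
  have h1 := h.θ_pos
  have h2 := Real.sqrt_pos.2 h.εg_pos
  rw [h.η_eq]; positivity

lemma Hbar_symm (h : p.Valid E Lg LH σ θ ω fstar) (x u v : Vec d) :
    inner ℝ (p.Hbar x u) v = inner ℝ u (p.Hbar x v) := by
  have h1 : inner ℝ (E x u) v = inner ℝ u (E x v) :=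
    (ContinuousLinearMap.isSelfAdjoint_iff_isSymmetric.1 (h.E_symm x)) u v
  rw [h.Hbar_eq, add_apply, add_apply, inner_add_left, inner_add_right, h1,
    hessian_symm h.contDiff]

lemma cMin_pos (h : p.Valid E Lg LH σ θ ω fstar) : 0 < cMin σ p.ρS p.ρN θ ω Lg LH := by
  have h1 := h.σ_pos
  have h2 := h.ρS_pos
  have h3 : 0 < 1 - 2 * p.ρS := by linarith [h.ρS_lt]
  have h4 := h.ρN_pos
  have h5 : 0 < 1 - p.ρN := by linarith [h.ρN_lt]
  have h6 := h.LH_pos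
  have h7 := h.ω_pos
  have h8 : 0 < c₀ σ θ Lg LH := c₀_pos h.σ_pos h.θ_pos h.Lg_nonneg
  refine lt_min (lt_min ?_ ?_) (lt_min ?_ ?_)
  · rw [c₁]; positivity
  · rw [c₂]; positivity
  · rw [c₃]
    have : 0 < min (ω ^ (3 / 2 : ℝ) * Real.sqrt (3 * (1 - p.ρN) / LH))
        ((1 - p.ρN) * σ * ω ^ 2) := lt_min (by positivity) (by positivity)
    positivity
  · rw [c₄]; positivity

lemma max_pos (h : p.Valid E Lg LH σ θ ω fstar) :
    0 < max (p.εg ^ (-(3 / 2) : ℝ)) (p.εH ^ (-3 : ℝ)) :=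
  lt_max_of_lt_left (Real.rpow_pos_of_pos h.εg_pos _)

lemma decrease_pos (h : p.Valid E Lg LH σ θ ω fstar) : 0 < p.decrease σ θ ω Lg LH :=
  div_pos h.cMin_pos h.max_pos

lemma decrease_le_εg (h : p.Valid E Lg LH σ θ ω fstar) :
    p.decrease σ θ ω Lg LH ≤ cMin σ p.ρS p.ρN θ ω Lg LH * p.εg ^ (3 / 2 : ℝ) := by
  rw [decrease, div_le_iff₀ h.max_pos, mul_assoc]
  refine le_mul_of_one_le_right h.cMin_pos.le ?_
  have h1 : p.εg ^ (3 / 2 : ℝ) * p.εg ^ (-(3 / 2) : ℝ) = 1 := by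
    rw [← Real.rpow_add h.εg_pos]; norm_num
  have h2 := Real.rpow_pos_of_pos h.εg_pos (3 / 2 : ℝ)
  calc (1 : ℝ) = _ := h1.symm
    _ ≤ _ := by gcongr; exact le_max_left _ _

lemma decrease_le_εH (h : p.Valid E Lg LH σ θ ω fstar) :
    p.decrease σ θ ω Lg LH ≤ c₄ p.ρN LH * p.εH ^ 3 := by
  have h3 : p.decrease σ θ ω Lg LH ≤ cMin σ p.ρS p.ρN θ ω Lg LH * p.εH ^ (3 : ℝ) := by
    rw [decrease, div_le_iff₀ h.max_pos, mul_assoc]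
    refine le_mul_of_one_le_right h.cMin_pos.le ?_
    have h1 : p.εH ^ (3 : ℝ) * p.εH ^ (-3 : ℝ) = 1 := by
      rw [← Real.rpow_add h.εH_pos]; norm_num
    have h2 := Real.rpow_pos_of_pos h.εH_pos (3 : ℝ)
    calc (1 : ℝ) = _ := h1.symm
      _ ≤ _ := by gcongr; exact le_max_right _ _
  refine h3.trans ?_
  have h4 : p.εH ^ (3 : ℝ) = p.εH ^ 3 := by norm_cast
  rw [h4]
  have h5 := h.εH_pos
  gcongr
  exact (min_le_right _ _).trans (min_le_right _ _)

lemma rpow_εg_le (h : p.Valid E Lg LH σ θ ω fstar) : p.εg ^ (3 / 2 : ℝ) ≤ p.εg := by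
  calc p.εg ^ (3 / 2 : ℝ) ≤ p.εg ^ (1 : ℝ) :=
        Real.rpow_le_rpow_of_exponent_ge h.εg_pos h.εg_le (by norm_num)
    _ = p.εg := Real.rpow_one _

/-- The factor 2 before `c₁` in `cMin` matches the half decrease asked of large-gradient steps. As
εg ≤ 1, the power of εg can be dropped. -/
lemma decrease_le_c₁ (h : p.Valid E Lg LH σ θ ω fstar) :
    p.decrease σ θ ω Lg LH / 2 ≤ c₁ σ p.ρS LH := by
  have h1 := h.decrease_le_εg
  have h2 : cMin σ p.ρS p.ρN θ ω Lg LH ≤ 2 * c₁ σ p.ρS LH :=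
    (min_le_left _ _).trans (min_le_left _ _)
  have h3 : p.εg ^ (3 / 2 : ℝ) ≤ 1 := h.rpow_εg_le.trans h.εg_le
  have h4 := mul_le_of_le_one_right h.cMin_pos.le h3
  linarith

lemma decrease_le_c₂ (h : p.Valid E Lg LH σ θ ω fstar) :
    p.decrease σ θ ω Lg LH / 2 ≤ c₂ σ p.ρS θ Lg LH * p.εg := by
  have h1 := h.decrease_le_εg
  have h2 : cMin σ p.ρS p.ρN θ ω Lg LH ≤ 2 * c₂ σ p.ρS θ Lg LH :=
    (min_le_left _ _).trans (min_le_right _ _)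
  have h4 := mul_le_mul_of_nonneg_left h.rpow_εg_le h.cMin_pos.le
  have h5 := mul_le_mul_of_nonneg_right h2 h.εg_pos.le
  linarith

lemma decrease_le_c₃ (h : p.Valid E Lg LH σ θ ω fstar) :
    p.decrease σ θ ω Lg LH / 2 ≤ c₃ σ p.ρN ω LH * p.εg ^ (3 / 2 : ℝ) := by
  have h1 := h.decrease_le_εg
  have h2 : cMin σ p.ρS p.ρN θ ω Lg LH ≤ 2 * c₃ σ p.ρN ω LH :=
    (min_le_right _ _).trans (min_le_left _ _)
  have h5 := mul_le_mul_of_nonneg_right h2 (Real.rpow_nonneg h.εg_pos.le (3 / 2))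
  linarith

/-- The main loop at a point with a large gradient. -/
theorem step_of_lt (h : p.Valid E Lg LH σ θ ω fstar) (ς : ℝ) (u x : Vec d)
    (hx : p.εg < ‖gradient p.f x‖)
    (hnpc : ∀ r, minres (p.Hbar x) (gradient p.f x) p.η = some (r, DirType.NPC) →
      ω * ‖gradient p.f x‖ ≤ ‖r‖) :
    ∃ y, p.step ς u x = Outcome.moved y ∧ p.f y ≤ p.f x ∧
      (‖gradient p.f y‖ ≤ p.εg ∨ p.decrease σ θ ω Lg LH / 2 ≤ p.f x - p.f y) := by
  have hg : gradient p.f x ≠ 0 := norm_pos_iff.1 (h.εg_pos.trans hx)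
  rcases exists_stop (h.Hbar_symm x) hg h.η_pos.le with ⟨j, hj⟩ | ⟨j, hj⟩
  · set e := (minresState (p.Hbar x) (gradient p.f x) j).s with he
    obtain ⟨h1, h2, h3, h4⟩ := hj.properties (h.Hbar_symm x) hg h.η_pos.le (h.krylovRegular x) he rfl
    have hge : inner ℝ (gradient p.f x) e ≤ -inner ℝ e (p.Hbar x e) := by
      rw [inner_sub_right, inner_neg_right, real_inner_comm (gradient p.f x) e] at h1
      linarith
    have hstep : p.step ς u x = lineSearchStep x e (p.armijo p.ρS x e ∩ Set.Iic 1) := by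
      rw [step, if_pos hx, minres_eq_of_stopSol hj]
    have hge' := hge
    have h2' := h2
    rw [h.Hbar_eq] at hge h2 h3 h4
    obtain ⟨α, hα, hdec⟩ := exists_isGreatest_sol h.contDiff h.LH_pos h.lipschitz (h.E_le x) h.σ_pos
      h.ρS_pos h.ρS_lt h.ε_le₂ hge h2
    have hdesc : p.ρS * α * (σ * ‖e‖ ^ 2) ≤ p.f x - p.f (x + α • e) := by
      have h5 := hα.1.1.2
      have h6 : p.ρS * α * (σ * ‖e‖ ^ 2) ≤ p.ρS * α * -inner ℝ (gradient p.f x) e :=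
        mul_le_mul_of_nonneg_left (by linarith) (mul_nonneg h.ρS_pos.le hα.1.1.1.le)
      linarith
    have hρS := h.ρS_pos
    have hσ := h.σ_pos
    have hα0 := hα.1.1.1
    refine ⟨x + α • e, hstep.trans (lineSearchStep_eq hα), ?_, ?_⟩
    · have : 0 ≤ p.ρS * α * (σ * ‖e‖ ^ 2) := by positivity
      linarith
    · rcases hdec with rfl | hdec
      -- The only case without a guaranteed decrease: a full step that reaches a small gradient.
      · by_cases hsmall : ‖gradient p.f (x + (1 : ℝ) • e)‖ ≤ p.εg
        · exact Or.inl hsmall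
        · right
          rw [not_le, one_smul] at hsmall
          have h5 := c₀_mul_sqrt_le_norm h.contDiff (h.hessian_le x) h.LH_pos h.lipschitz (h.E_le x)
            h.εg_pos h.σ_pos h.θ_pos h.η_eq h.ε_le₁ rfl h3 h4 hsmall
          have hc₀ := c₀_pos (LH := LH) h.σ_pos h.θ_pos h.Lg_nonneg
          have h6 : c₂ σ p.ρS θ Lg LH * p.εg ≤ p.ρS * 1 * (σ * ‖e‖ ^ 2) := by
            calc c₂ σ p.ρS θ Lg LH * p.εg
                = p.ρS * 1 * (σ * (c₀ σ θ Lg LH * Real.sqrt p.εg) ^ 2) := by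
                  rw [c₂, mul_pow, Real.sq_sqrt h.εg_pos.le]; ring
              _ ≤ _ := by gcongr
          exact h.decrease_le_c₂.trans (h6.trans hdesc)
      · exact Or.inr (h.decrease_le_c₁.trans hdec)
  · set r := (minresState (p.Hbar x) (gradient p.f x) j).r with hr
    obtain ⟨h1, h2, h3⟩ := hj.properties (h.Hbar_symm x) hg h.η_pos.le hr
    have hstep : p.step ς u x = lineSearchStep x r (p.armijo p.ρN x r) := by
      rw [step, if_pos hx, minres_eq_of_stopNpc hj]
    have hrω := hnpc r (minres_eq_of_stopNpc hj)
    rw [h.Hbar_eq] at h2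
    obtain ⟨α, hα, hdec⟩ := exists_isGreatest_npc h.contDiff h.fstar_le h.LH_pos h.lipschitz
      (h.E_le x) h.ε_pos h.ρN_pos h.ρN_lt h1 h3 h2
    have h4 : ω * p.εg ≤ ‖r‖ := (mul_le_mul_of_nonneg_left hx.le h.ω_pos.le).trans hrω
    have h5 := c₃_mul_le h.LH_pos h.ε_pos h.εg_pos h.ρN_pos h.ρN_lt h.σ_pos h.η_pos h.ω_pos h.ε_le₁ h4
    have h6 := h.decrease_le_c₃.trans (h5.trans hdec)
    have h7 := h.decrease_pos
    exact ⟨x + α • r, hstep.trans (lineSearchStep_eq hα), by linarith, Or.inr h6⟩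

/-- The shifted inexact Hessian used at points with a small gradient. -/
noncomputable def _root_.NewtonMR.Problem.shiftedHbar (p : Problem d) (x : Vec d) :
    Vec d →L[ℝ] Vec d :=
  p.Hbar x + (1 / 2 * (p.εH - p.ε)) • ContinuousLinearMap.id ℝ (Vec d)

lemma shiftedHbar_symm (h : p.Valid E Lg LH σ θ ω fstar) (x u v : Vec d) :
    inner ℝ (p.shiftedHbar x u) v = inner ℝ u (p.shiftedHbar x v) := by
  simp only [shiftedHbar, add_apply, smul_apply, ContinuousLinearMap.id_apply, inner_add_left,
    inner_add_right, h.Hbar_symm, real_inner_smul_left, inner_smul_right]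

lemma norm_npcDirection {ς : ℝ} (hς : ς = 1 ∨ ς = -1) {x r : Vec d} (hr : r ≠ 0) :
    ‖p.npcDirection ς x r‖ = 1 := by
  have hn : ‖r‖ ≠ 0 := norm_ne_zero_iff.2 hr
  have hs : |signWith ς (inner ℝ (gradient p.f x) r)| = 1 := by
    rw [signWith]
    split_ifs
    · rcases hς with rfl | rfl <;> simp
    · simp
    · simp
  rw [npcDirection, norm_smul, Real.norm_eq_abs, abs_mul, abs_neg, hs, abs_inv, abs_norm, one_mul,
    inv_mul_cancel₀ hn]

lemma inner_npcDirection_nonpos (ς : ℝ) (x r : Vec d) :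
    inner ℝ (gradient p.f x) (p.npcDirection ς x r) ≤ 0 := by
  have hs : 0 ≤ signWith ς (inner ℝ (gradient p.f x) r) * inner ℝ (gradient p.f x) r := by
    rw [signWith]
    split_ifs with h1 h2
    · rw [h1, mul_zero]
    · linarith
    · linarith
  rw [npcDirection, inner_smul_right]
  have := mul_nonneg (inv_nonneg.2 (norm_nonneg r)) hs
  linarith

/-- The main loop at a point with a small gradient. -/
theorem step_of_le (h : p.Valid E Lg LH σ θ ω fstar) {ς : ℝ} (hς : ς = 1 ∨ ς = -1) {u x : Vec d}
    (hu : u ≠ 0) (hx : ‖gradient p.f x‖ ≤ p.εg) :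
    (∃ y, p.step ς u x = Outcome.moved y ∧ p.decrease σ θ ω Lg LH ≤ p.f x - p.f y) ∨
      (p.step ς u x = Outcome.terminated ∧ ∃ j, MinresStopSol (p.shiftedHbar x) u 0 j) := by
  rcases exists_stop (h.shiftedHbar_symm x) hu le_rfl with ⟨j, hj⟩ | ⟨j, hj⟩
  · right
    refine ⟨?_, j, hj⟩
    have h1 := minres_eq_of_stopSol hj
    rw [shiftedHbar] at h1
    rw [step, if_neg (not_lt.2 hx), h1]
  · left
    set r := (minresState (p.shiftedHbar x) u j).r with hr
    obtain ⟨h1, h2, -⟩ := hj.properties (h.shiftedHbar_symm x) hu le_rfl hr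
    have hm := minres_eq_of_stopNpc hj
    rw [shiftedHbar] at hm
    have hstep : p.step ς u x = lineSearchStep x (p.npcDirection ς x r)
        (p.curvatureArmijo x (p.npcDirection ς x r)) := by
      rw [step, if_neg (not_lt.2 hx), hm]
      rfl
    set e := p.npcDirection ς x r with he
    have he1 : ‖e‖ = 1 := norm_npcDirection hς h1
    have hcurv : inner ℝ e ((hessian p.f x + E x) e) ≤ -(1 / 2 * (p.εH - p.ε)) := by
      have h3 : inner ℝ e (p.shiftedHbar x e) ≤ 0 := by
        rw [he, npcDirection, map_smul, real_inner_smul_left, inner_smul_right, ← mul_assoc]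
        exact mul_nonpos_of_nonneg_of_nonpos (mul_self_nonneg _) h2
      rw [shiftedHbar, add_apply, smul_apply, ContinuousLinearMap.id_apply, inner_add_right,
        inner_smul_right, real_inner_self_eq_norm_sq, he1, h.Hbar_eq] at h3
      linarith
    obtain ⟨α, hα, hdec⟩ := exists_isGreatest_curvature h.contDiff h.fstar_le h.LH_pos h.lipschitz
      (h.E_le x) h.εH_pos h.ρN_pos h.ρN_lt h.ε_le₄ h.ε_le₅ he1 (inner_npcDirection_nonpos ς x r)
      hcurv
    rw [← h.Hbar_eq] at hα
    exact ⟨x + α • e, hstep.trans (lineSearchStep_eq hα), h.decrease_le_εH.trans hdec⟩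

/-- Positive semidefiniteness of the shifted inexact Hessian implies second-order optimality. -/
theorem isSecondOrderOptimal (h : p.Valid E Lg LH σ θ ω fstar) {x : Vec d}
    (hx : ‖gradient p.f x‖ ≤ p.εg) (hpsd : ∀ v, 0 ≤ inner ℝ v (p.shiftedHbar x v)) :
    IsSecondOrderOptimal p.f p.εg p.εH x := by
  refine ⟨hx, fun μ hμ => ?_⟩
  obtain ⟨v, hv⟩ := hμ.exists_hasEigenvector
  have h1 : hessian p.f x v = μ • v := hv.apply_eq_smul
  have hv0 : 0 < ‖v‖ := norm_pos_iff.2 hv.2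
  have h2 := hpsd v
  have h3 : |inner ℝ v (E x v)| ≤ p.ε * ‖v‖ ^ 2 := by
    refine (abs_real_inner_le_norm _ _).trans ?_
    have := (E x).le_of_opNorm_le (h.E_le x) v
    calc _ ≤ ‖v‖ * (p.ε * ‖v‖) := by gcongr
      _ = _ := by ring
  rw [shiftedHbar, add_apply, smul_apply, ContinuousLinearMap.id_apply, inner_add_right,
    inner_smul_right, real_inner_self_eq_norm_sq, h.Hbar_eq, add_apply, inner_add_right, h1,
    inner_smul_right, real_inner_self_eq_norm_sq] at h2
  have h4 := (abs_le.1 h3).2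
  have h5 : 0 ≤ (μ + p.ε + 1 / 2 * (p.εH - p.ε)) * ‖v‖ ^ 2 := by linarith
  -- This gives μ ≥ -(εH + ε)/2, which exceeds -εH since ε ≤ εH / 10.
  have h6 := nonneg_of_mul_nonneg_left h5 (by positivity)
  have h7 := h.ε_le₄
  have h8 := h.εH_pos
  linarith

end Problem.Valid

end Step

/-! ### Measurability of MINRES and of the step size -/

section Measurability

variable {d : ℕ} {Y : Type*} [MeasurableSpace Y]

lemma measurable_clm_apply {A : Y → Vec d →L[ℝ] Vec d} (hA : ∀ v, Measurable fun y => A y v)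
    {u : Y → Vec d} (hu : Measurable u) : Measurable fun y => A y (u y) := by
  have h1 : (fun y => A y (u y)) =
      fun y => ∑ i, inner ℝ (EuclideanSpace.basisFun (Fin d) ℝ i) (u y) •
        A y (EuclideanSpace.basisFun (Fin d) ℝ i) := by
    ext1 y
    conv_lhs => rw [← (EuclideanSpace.basisFun (Fin d) ℝ).sum_repr' (u y)]
    rw [map_sum]
    simp only [map_smul]
  rw [h1]
  refine Finset.measurable_fun_sum _ fun i _ => ?_
  have h2 : Measurable fun y => inner ℝ (EuclideanSpace.basisFun (Fin d) ℝ i) (u y) :=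
    measurable_const.inner hu
  exact h2.smul (hA (EuclideanSpace.basisFun (Fin d) ℝ i))

/-- Measurability of all MINRES variables. -/
structure MeasurableState (S : Y → MinresState d) : Prop where
  v : Measurable fun y => (S y).v
  vPrev : Measurable fun y => (S y).vPrev
  w : Measurable fun y => (S y).w
  wPrev : Measurable fun y => (S y).wPrev
  s : Measurable fun y => (S y).s
  r : Measurable fun y => (S y).r
  β : Measurable fun y => (S y).β
  c : Measurable fun y => (S y).c
  sn : Measurable fun y => (S y).sn
  φ : Measurable fun y => (S y).φ
  δ₁ : Measurable fun y => (S y).δ₁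
  ϵ : Measurable fun y => (S y).ϵ

variable {A : Y → Vec d →L[ℝ] Vec d} {g : Y → Vec d} {S : Y → MinresState d}

lemma MeasurableState.init (hg : Measurable g) :
    MeasurableState fun y => MinresState.init (g y) := by
  constructor <;> simp only [MinresState.init] <;> fun_prop

lemma MeasurableState.α (hA : ∀ v, Measurable fun y => A y v) (hS : MeasurableState S) :
    Measurable fun y => (S y).α (A y) :=
  hS.v.inner (measurable_clm_apply hA hS.v)

lemma MeasurableState.q (hA : ∀ v, Measurable fun y => A y v) (hS : MeasurableState S) :
    Measurable fun y => (S y).q (A y) :=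
  ((measurable_clm_apply hA hS.v).sub (hS.β.smul hS.vPrev)).sub ((hS.α hA).smul hS.v)

lemma MeasurableState.βNext (hA : ∀ v, Measurable fun y => A y v) (hS : MeasurableState S) :
    Measurable fun y => (S y).βNext (A y) :=
  (hS.q hA).norm

lemma MeasurableState.δ₂ (hA : ∀ v, Measurable fun y => A y v) (hS : MeasurableState S) :
    Measurable fun y => (S y).δ₂ (A y) :=
  (hS.c.mul hS.δ₁).add (hS.sn.mul (hS.α hA))

lemma MeasurableState.γ₁ (hA : ∀ v, Measurable fun y => A y v) (hS : MeasurableState S) :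
    Measurable fun y => (S y).γ₁ (A y) :=
  (hS.sn.mul hS.δ₁).sub (hS.c.mul (hS.α hA))

lemma MeasurableState.δNext (hA : ∀ v, Measurable fun y => A y v) (hS : MeasurableState S) :
    Measurable fun y => (S y).δNext (A y) :=
  hS.c.neg.mul (hS.βNext hA)

lemma MeasurableState.γ₂ (hA : ∀ v, Measurable fun y => A y v) (hS : MeasurableState S) :
    Measurable fun y => (S y).γ₂ (A y) :=
  (((hS.γ₁ hA).pow_const 2).add ((hS.βNext hA).pow_const 2)).sqrt

lemma MeasurableState.next (hA : ∀ v, Measurable fun y => A y v) (hS : MeasurableState S) :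
    MeasurableState fun y => (S y).next (A y) := by
  classical
  have hγset : MeasurableSet {y | (S y).γ₂ (A y) ≠ 0} :=
    (measurableSet_eq_fun (hS.γ₂ hA) measurable_const).compl
  have hβset : MeasurableSet {y | (S y).βNext (A y) ≠ 0} :=
    (measurableSet_eq_fun (hS.βNext hA) measurable_const).compl
  have hsn : Measurable fun y => (S y).βNext (A y) / (S y).γ₂ (A y) :=
    (hS.βNext hA).div (hS.γ₂ hA)
  have hc : Measurable fun y => (S y).γ₁ (A y) / (S y).γ₂ (A y) := (hS.γ₁ hA).div (hS.γ₂ hA)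
  have hv' : Measurable fun y => if (S y).βNext (A y) ≠ 0 then
      ((S y).βNext (A y))⁻¹ • (S y).q (A y) else 0 :=
    Measurable.ite hβset ((hS.βNext hA).inv.smul (hS.q hA)) measurable_const
  have hw' : Measurable fun y => ((S y).γ₂ (A y))⁻¹ •
      ((S y).v - (S y).δ₂ (A y) • (S y).w - (S y).ϵ • (S y).wPrev) :=
    (hS.γ₂ hA).inv.smul ((hS.v.sub ((hS.δ₂ hA).smul hS.w)).sub (hS.ϵ.smul hS.wPrev))
  have hr' : Measurable fun y => if (S y).βNext (A y) ≠ 0 then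
      ((S y).βNext (A y) / (S y).γ₂ (A y)) ^ 2 • (S y).r
        - (((S y).βNext (A y) / (S y).γ₂ (A y) * (S y).φ) *
          ((S y).γ₁ (A y) / (S y).γ₂ (A y))) • (if (S y).βNext (A y) ≠ 0 then
            ((S y).βNext (A y))⁻¹ • (S y).q (A y) else 0) else 0 :=
    Measurable.ite hβset (((hsn.pow_const 2).smul hS.r).sub (((hsn.mul hS.φ).mul hc).smul hv'))
      measurable_const
  have hite : ∀ {Z : Type} [MeasurableSpace Z] (F : MinresState d → Z) {a b : Y → Z},
      Measurable a → Measurable b → (∀ y, (S y).γ₂ (A y) ≠ 0 → F ((S y).next (A y)) = a y) →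
      (∀ y, ¬ (S y).γ₂ (A y) ≠ 0 → F ((S y).next (A y)) = b y) →
      Measurable fun y => F ((S y).next (A y)) := by
    intro Z _ F a b ha hb h1 h2
    have h3 : (fun y => F ((S y).next (A y))) =
        fun y => if (S y).γ₂ (A y) ≠ 0 then a y else b y := by
      ext1 y
      split_ifs with h
      · exact h1 y h
      · exact h2 y h
    rw [h3]
    exact Measurable.ite hγset ha hb
  refine ⟨hite (·.v) hv' (measurable_const (a := 0)) ?_ ?_, hite (·.vPrev) hS.v hS.v ?_ ?_,
    hite (·.w) hw' (measurable_const (a := 0)) ?_ ?_, hite (·.wPrev) hS.w hS.w ?_ ?_,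
    hite (·.s) (hS.s.add ((hc.mul hS.φ).smul hw')) hS.s ?_ ?_, hite (·.r) hr' hS.r ?_ ?_,
    hite (·.β) (hS.βNext hA) (hS.βNext hA) ?_ ?_, hite (·.c) hc (measurable_const (a := 0)) ?_ ?_,
    hite (·.sn) hsn (measurable_const (a := 1)) ?_ ?_, hite (·.φ) (hsn.mul hS.φ) hS.φ ?_ ?_,
    hite (·.δ₁) (hS.δNext hA) (hS.δNext hA) ?_ ?_,
    hite (·.ϵ) (hS.sn.mul (hS.βNext hA)) (hS.sn.mul (hS.βNext hA)) ?_ ?_⟩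
  all_goals
    intro y hy
    rw [MinresState.next]
    first
    | (rw [if_pos hy]) <;> rfl
    | (rw [if_neg hy]) <;> rfl

lemma measurableState_minresState (hA : ∀ v, Measurable fun y => A y v) (hg : Measurable g)
    (j : ℕ) : MeasurableState fun y => minresState (A y) (g y) j := by
  induction j with
  | zero => exact .init hg
  | succ j ih => exact ih.next hA

lemma measurableSet_solTest (hA : ∀ v, Measurable fun y => A y v) (hg : Measurable g) (η : ℝ)
    (j : ℕ) : MeasurableSet {y | minresSolTest (A y) (g y) η j} := by
  have hS := measurableState_minresState hA hg j
  exact measurableSet_le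
    (hS.φ.mul (((hS.γ₁ hA).pow_const 2).add ((hS.δNext hA).pow_const 2)).sqrt)
    (measurable_const.mul ((hg.norm.pow_const 2).sub (hS.φ.pow_const 2)).sqrt)

lemma measurableSet_npcTest (hA : ∀ v, Measurable fun y => A y v) (hg : Measurable g) (j : ℕ) :
    MeasurableSet {y | minresNpcTest (A y) (g y) j} := by
  have hS := measurableState_minresState hA hg j
  exact measurableSet_le measurable_const (hS.c.mul (hS.γ₁ hA))

lemma measurableSet_not_stopped (hA : ∀ v, Measurable fun y => A y v) (hg : Measurable g) (η : ℝ)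
    (j : ℕ) : MeasurableSet {y | ∀ i < j, ¬ minresSolTest (A y) (g y) η i ∧
      ¬ minresNpcTest (A y) (g y) i} := by
  simp only [Set.ofPred_forall]
  exact .iInter fun i => .iInter fun _ =>
    (measurableSet_solTest hA hg η i).compl.inter (measurableSet_npcTest hA hg i).compl

lemma measurableSet_stopSol (hA : ∀ v, Measurable fun y => A y v) (hg : Measurable g) (η : ℝ)
    (j : ℕ) : MeasurableSet {y | MinresStopSol (A y) (g y) η j} :=
  (measurableSet_solTest hA hg η j).inter (measurableSet_not_stopped hA hg η j)

lemma measurableSet_stopNpc (hA : ∀ v, Measurable fun y => A y v) (hg : Measurable g) (η : ℝ)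
    (j : ℕ) : MeasurableSet {y | MinresStopNpc (A y) (g y) η j} :=
  ((measurableSet_solTest hA hg η j).compl.inter (measurableSet_npcTest hA hg j)).inter
    (measurableSet_not_stopped hA hg η j)

lemma minres_eq_none {A : Vec d →L[ℝ] Vec d} {g : Vec d} {η : ℝ}
    (h1 : ∀ j, ¬ MinresStopSol A g η j) (h2 : ∀ j, ¬ MinresStopNpc A g η j) :
    minres A g η = none := by
  classical
  rw [minres, dif_neg]
  intro hex
  have hmin : ∀ i < Nat.find hex, ¬ minresSolTest A g η i ∧ ¬ minresNpcTest A g i :=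
    fun i hi => not_or.1 (Nat.find_min hex hi)
  by_cases h : minresSolTest A g η (Nat.find hex)
  · exact h1 _ ⟨h, hmin⟩
  · exact h2 _ ⟨⟨h, (Nat.find_spec hex).resolve_left h⟩, hmin⟩

open Classical in
/-- The greatest element of a set of reals, or `0` if there is none. -/
noncomputable def greatest (S : Set ℝ) : ℝ :=
  if h : ∃ α, IsGreatest S α then Classical.choose h else 0

/-- Replaces an uncountable union by countable operations. Continuity gives approximate solutions at
rationals; conversely the minimum over the compact interval is below every 1 / (n + 1). -/
lemma exists_mem_Icc_nonpos_iff {h : ℝ → ℝ} (hh : Continuous h) {a b : ℝ} (hab : a < b) :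
    (∃ α ∈ Set.Icc a b, h α ≤ 0) ↔
      ∀ n : ℕ, ∃ q : ℚ, (q : ℝ) ∈ Set.Icc a b ∧ h q < 1 / ((n : ℝ) + 1) := by
  constructor
  · rintro ⟨α, hα, hα0⟩ n
    have hpos : (0 : ℝ) < 1 / ((n : ℝ) + 1) := by positivity
    have hopen : IsOpen {x | h x < 1 / ((n : ℝ) + 1)} := isOpen_lt hh continuous_const
    -- α may be an irrational endpoint, so rationals are sought in the open interval.
    have hcl : α ∈ closure (Set.Ioo a b) := by rwa [closure_Ioo hab.ne]
    obtain ⟨z, hz, hz'⟩ := mem_closure_iff.1 hcl _ hopen (hα0.trans_lt hpos)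
    obtain ⟨q, hq, hq'⟩ := Rat.denseRange_cast.exists_mem_open (hopen.inter isOpen_Ioo) ⟨z, hz, hz'⟩
    exact ⟨q, Set.Ioo_subset_Icc_self hq', hq⟩
  · intro hq
    obtain ⟨α, hα, hmin⟩ := isCompact_Icc.exists_isMinOn (Set.nonempty_Icc.2 hab.le)
      hh.continuousOn
    refine ⟨α, hα, le_of_forall_pos_lt_add fun δ hδ => ?_⟩
    obtain ⟨n, hn⟩ := exists_nat_one_div_lt hδ
    obtain ⟨q, hqI, hqn⟩ := hq n
    have := hmin hqI
    simp only [Set.mem_ofPred_eq] at this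
    linarith

/-- The largest step size that satisfies a continuous inequality depends measurably on
parameters. -/
theorem measurable_greatest {h : Y → ℝ → ℝ} (hm : ∀ α, Measurable fun y => h y α)
    (hc : ∀ y, Continuous (h y)) :
    Measurable fun y => greatest {α | 0 < α ∧ h y α ≤ 0} := by
  have hIcc : ∀ a b : ℝ, a < b → MeasurableSet {y | ∃ α ∈ Set.Icc a b, h y α ≤ 0} := by
    intro a b hab
    have h1 : {y | ∃ α ∈ Set.Icc a b, h y α ≤ 0} =
        ⋂ n : ℕ, ⋃ q : ℚ, {y | (q : ℝ) ∈ Set.Icc a b ∧ h y q < 1 / ((n : ℝ) + 1)} := by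
      ext y
      simp only [Set.mem_ofPred_eq, exists_mem_Icc_nonpos_iff (hc y) hab, Set.mem_iInter,
        Set.mem_iUnion]
    rw [h1]
    exact .iInter fun n => .iUnion fun q =>
      (MeasurableSet.const _).inter (measurableSet_lt (hm _) measurable_const)
  have hge : ∀ a : ℝ, MeasurableSet {y | ∃ α, a ≤ α ∧ h y α ≤ 0} := by
    intro a
    have h1 : {y | ∃ α, a ≤ α ∧ h y α ≤ 0} =
        ⋃ n : ℕ, {y | ∃ α ∈ Set.Icc a (a + n + 1), h y α ≤ 0} := by
      ext y
      simp only [Set.mem_ofPred_eq, Set.mem_iUnion]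
      constructor
      · rintro ⟨α, hα, hα0⟩
        obtain ⟨n, hn⟩ := exists_nat_ge (α - a)
        exact ⟨n, α, ⟨hα, by linarith⟩, hα0⟩
      · rintro ⟨n, α, hα, hα0⟩
        exact ⟨α, hα.1, hα0⟩
    rw [h1]
    exact .iUnion fun n => hIcc _ _ (by linarith [(Nat.cast_nonneg n : (0 : ℝ) ≤ n)])
  have hpos : MeasurableSet {y | ∃ α, 0 < α ∧ h y α ≤ 0} := by
    have h1 : {y | ∃ α, 0 < α ∧ h y α ≤ 0} =
        ⋃ n : ℕ, {y | ∃ α, 1 / ((n : ℝ) + 1) ≤ α ∧ h y α ≤ 0} := by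
      ext y
      simp only [Set.mem_ofPred_eq, Set.mem_iUnion]
      constructor
      · rintro ⟨α, hα, hα0⟩
        obtain ⟨n, hn⟩ := exists_nat_one_div_lt hα
        exact ⟨n, α, hn.le, hα0⟩
      · rintro ⟨n, α, hα, hα0⟩
        exact ⟨α, lt_of_lt_of_le (by positivity) hα, hα0⟩
    rw [h1]
    exact .iUnion fun n => hge _
  have hbdd : MeasurableSet {y | ∃ n : ℕ, ¬ ∃ α, (n : ℝ) + 1 ≤ α ∧ h y α ≤ 0} := by
    simp only [Set.ofPred_exists]
    exact .iUnion fun n => (hge _).compl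
  -- By continuity a greatest element exists exactly when the set is nonempty and bounded above. The
  -- threshold n + 1 is positive, so the sign condition may be dropped there.
  have hex : ∀ y, (∃ α, IsGreatest {α | 0 < α ∧ h y α ≤ 0} α) ↔
      (∃ α, 0 < α ∧ h y α ≤ 0) ∧ ∃ n : ℕ, ¬ ∃ α, (n : ℝ) + 1 ≤ α ∧ h y α ≤ 0 := by
    intro y
    constructor
    · rintro ⟨α, hα, hαmax⟩
      obtain ⟨n, hn⟩ := exists_nat_ge α
      refine ⟨⟨α, hα⟩, n, ?_⟩
      rintro ⟨β, hβ, hβ0⟩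
      have := hαmax ⟨by linarith [(Nat.cast_nonneg n : (0 : ℝ) ≤ n)], hβ0⟩
      linarith
    · rintro ⟨⟨α, hα, hα0⟩, n, hn⟩
      obtain ⟨β, hβ, -⟩ := exists_isGreatest_of_continuous (b := (n : ℝ) + 1) (hc y) hα hα0
        fun β _ hβ0 => by
          by_contra hcon
          exact hn ⟨β, (not_le.1 hcon).le, hβ0⟩
      exact ⟨β, hβ⟩
  have hG : MeasurableSet {y | ∃ α, IsGreatest {α | 0 < α ∧ h y α ≤ 0} α} := by
    simp only [hex]
    exact hpos.inter hbdd
  refine measurable_of_Ici fun c => ?_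
  rcases le_or_gt c 0 with hc0 | hc0
  · convert MeasurableSet.univ
    refine Set.eq_univ_of_forall fun y => ?_
    simp only [Set.mem_preimage, Set.mem_Ici, greatest]
    split_ifs with hy
    · exact hc0.trans (Classical.choose_spec hy).1.1.le
    · exact hc0
  · convert hG.inter (hge c) using 1
    ext y
    simp only [Set.mem_preimage, Set.mem_Ici, greatest, Set.mem_inter_iff, Set.mem_ofPred_eq]
    split_ifs with hy
    · constructor
      · intro hcy
        exact ⟨hy, _, hcy, (Classical.choose_spec hy).1.2⟩
      · rintro ⟨-, α, hα, hα0⟩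
        exact hα.trans ((Classical.choose_spec hy).2 ⟨hc0.trans_le hα, hα0⟩)
    · constructor
      · intro hcy; linarith
      · rintro ⟨hy', -⟩; exact absurd hy' hy

/-- Measurability of a function that is given by measurable functions on the members of a countable
family of measurable sets and on the complement of their union. -/
lemma measurable_of_countable_cover {Z ι : Type*} [MeasurableSpace Z] [Countable ι] {F₀ F : Y → Z}
    {G : ι → Y → Z} {B : ι → Set Y} (hB : ∀ i, MeasurableSet (B i)) (hG : ∀ i, Measurable (G i))
    (hF₀ : Measurable F₀) (h1 : ∀ i, ∀ y ∈ B i, F y = G i y)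
    (h2 : ∀ y, (∀ i, y ∉ B i) → F y = F₀ y) : Measurable F := by
  intro T hT
  have h3 : F ⁻¹' T = (⋃ i, B i ∩ G i ⁻¹' T) ∪ ((⋃ i, B i)ᶜ ∩ F₀ ⁻¹' T) := by
    ext y
    simp only [Set.mem_preimage, Set.mem_union, Set.mem_iUnion, Set.mem_inter_iff,
      Set.mem_compl_iff, not_exists]
    constructor
    · intro hy
      by_cases hex : ∃ i, y ∈ B i
      · obtain ⟨i, hi⟩ := hex
        exact Or.inl ⟨i, hi, h1 i y hi ▸ hy⟩
      · push Not at hex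
        exact Or.inr ⟨hex, h2 y hex ▸ hy⟩
    · rintro (⟨i, hi, hy⟩ | ⟨hex, hy⟩)
      · rw [h1 i y hi]; exact hy
      · rw [h2 y hex]; exact hy
  rw [h3]
  exact (MeasurableSet.iUnion fun i => (hB i).inter (hG i hT)).union
    ((MeasurableSet.iUnion hB).compl.inter (hF₀ hT))

end Measurability

/-! ### The iterates as measurable functions of the draws -/

section Run

variable {d : ℕ} {p : Problem d} {E : Vec d → Vec d →L[ℝ] Vec d} {Lg LH σ θ ω fstar : ℝ}

/-- The next iterate, or the default value if there is none. -/
def Outcome.getD : Outcome d → Vec d → Vec d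
  | Outcome.moved y, _ => y
  | Outcome.terminated, x => x
  | Outcome.stuck, x => x

lemma lineSearchStep_getD (x e : Vec d) (S : Set ℝ) :
    (lineSearchStep x e S).getD x = x + greatest S • e := by
  rw [lineSearchStep, greatest]
  split_ifs
  · rfl
  · simp [Outcome.getD]

/-- The run of the algorithm, prolonged by a constant sequence when it has ended. -/
noncomputable def Problem.run (p : Problem d) (x₀ : Vec d) (ς : ℕ → ℝ) (U : ℕ → Vec d) : ℕ → Vec d
  | 0 => x₀
  | k + 1 => (p.step (ς k) (U k) (p.run x₀ ς U k)).getD (p.run x₀ ς U k)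

lemma Problem.run_eq_of_iterate {x₀ : Vec d} {ς : ℕ → ℝ} {U : ℕ → Vec d} {k : ℕ} {x : Vec d}
    (h : p.iterate x₀ ς U k = some x) : p.run x₀ ς U k = x := by
  induction k generalizing x with
  | zero => simpa [Problem.iterate, Problem.run] using h
  | succ k ih =>
    rw [Problem.iterate] at h
    split at h
    · rename_i z hz
      split at h
      · rename_i y hy
        rw [Problem.run, ih hz, hy]
        simpa [Outcome.getD] using h
      · simp at h
      · simp at h
    · simp at h

/-- The iterate x_k uses only the draws before k, which is the source of its independence from draw
k. -/
lemma Problem.run_congr {x₀ : Vec d} {ς : ℕ → ℝ} {U U' : ℕ → Vec d} {k : ℕ}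
    (h : ∀ i < k, U i = U' i) : p.run x₀ ς U k = p.run x₀ ς U' k := by
  induction k with
  | zero => rfl
  | succ k ih =>
    rw [Problem.run, Problem.run, ih fun i hi => h i (hi.trans k.lt_succ_self),
      h k k.lt_succ_self]

namespace Problem.Valid

lemma continuous_gradient (h : p.Valid E Lg LH σ θ ω fstar) : Continuous (gradient p.f) :=
  (contDiff_gradient h.contDiff).continuous

lemma measurable_Hbar (h : p.Valid E Lg LH σ θ ω fstar) (v : Vec d) :
    Measurable fun x => p.Hbar x v := by
  simp only [h.Hbar_eq, add_apply]
  refine Measurable.add ?_ (h.E_meas v)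
  have h1 : Continuous fun x => hessian p.f x :=
    (contDiff_gradient h.contDiff).continuous_fderiv one_ne_zero
  exact (h1.clm_apply continuous_const).measurable

lemma measurable_shiftedHbar (h : p.Valid E Lg LH σ θ ω fstar) (v : Vec d) :
    Measurable fun x => p.shiftedHbar x v := by
  simp only [shiftedHbar, add_apply]
  exact (h.measurable_Hbar v).add measurable_const

lemma measurable_armijo_point (h : p.Valid E Lg LH σ θ ω fstar) (ρ : ℝ) {Y : Type*}
    [MeasurableSpace Y] {X e : Y → Vec d} (hX : Measurable X) (he : Measurable e) :
    Measurable fun y => X y + greatest (p.armijo ρ (X y) (e y)) • e y := by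
  have hf := h.contDiff.continuous
  have h1 : ∀ y, p.armijo ρ (X y) (e y) = {α | 0 < α ∧
      p.f (X y + α • e y) - (p.f (X y) + ρ * α * inner ℝ (gradient p.f (X y)) (e y)) ≤ 0} := by
    intro y
    simp only [armijo, sub_nonpos]
  simp only [h1]
  refine hX.add (Measurable.fun_smul ?_ he)
  refine measurable_greatest (h := fun y α => p.f (X y + α • e y)
    - (p.f (X y) + ρ * α * inner ℝ (gradient p.f (X y)) (e y))) (fun α => ?_) fun y => ?_
  · exact (hf.measurable.comp (hX.add (he.const_smul α))).sub ((hf.measurable.comp hX).add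
      (((h.continuous_gradient.measurable.comp hX).inner he).const_mul _))
  · fun_prop

lemma measurable_armijo_Iic_point (h : p.Valid E Lg LH σ θ ω fstar) (ρ : ℝ) {Y : Type*}
    [MeasurableSpace Y] {X e : Y → Vec d} (hX : Measurable X) (he : Measurable e) :
    Measurable fun y => X y + greatest (p.armijo ρ (X y) (e y) ∩ Set.Iic 1) • e y := by
  have hf := h.contDiff.continuous
  have h1 : ∀ y, p.armijo ρ (X y) (e y) ∩ Set.Iic 1 = {α | 0 < α ∧ max
      (p.f (X y + α • e y) - (p.f (X y) + ρ * α * inner ℝ (gradient p.f (X y)) (e y)))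
      (α - 1) ≤ 0} := by
    intro y
    ext α
    simp only [armijo, max_le_iff, sub_nonpos, Set.mem_ofPred_eq, Set.mem_inter_iff, Set.mem_Iic]
    tauto
  simp only [h1]
  refine hX.add (Measurable.fun_smul ?_ he)
  refine measurable_greatest (h := fun y α => max (p.f (X y + α • e y)
    - (p.f (X y) + ρ * α * inner ℝ (gradient p.f (X y)) (e y))) (α - 1)) (fun α => ?_) fun y => ?_
  · exact ((hf.measurable.comp (hX.add (he.const_smul α))).sub ((hf.measurable.comp hX).add
      (((h.continuous_gradient.measurable.comp hX).inner he).const_mul _))).max measurable_const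
  · fun_prop

lemma measurable_curvatureArmijo_point (h : p.Valid E Lg LH σ θ ω fstar) {Y : Type*}
    [MeasurableSpace Y] {X e : Y → Vec d} (hX : Measurable X) (he : Measurable e) :
    Measurable fun y => X y + greatest (p.curvatureArmijo (X y) (e y)) • e y := by
  have hf := h.contDiff.continuous
  have h1 : ∀ y, p.curvatureArmijo (X y) (e y) = {α | 0 < α ∧ p.f (X y + α • e y)
      - (p.f (X y) + 1 / 2 * p.ρN * α ^ 2 * inner ℝ (e y) (p.Hbar (X y) (e y))) ≤ 0} := by
    intro y
    simp only [curvatureArmijo, sub_nonpos]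
  simp only [h1]
  refine hX.add (Measurable.fun_smul ?_ he)
  refine measurable_greatest (h := fun y α => p.f (X y + α • e y)
    - (p.f (X y) + 1 / 2 * p.ρN * α ^ 2 * inner ℝ (e y) (p.Hbar (X y) (e y))))
    (fun α => ?_) fun y => ?_
  · have h2 : Measurable fun y => p.Hbar (X y) (e y) :=
      measurable_clm_apply (fun v => (h.measurable_Hbar v).comp hX) he
    exact (hf.measurable.comp (hX.add (he.const_smul α))).sub ((hf.measurable.comp hX).add
      ((he.inner h2).const_mul _))
  · fun_prop

lemma measurable_npcDirection (h : p.Valid E Lg LH σ θ ω fstar) (ς : ℝ) {Y : Type*}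
    [MeasurableSpace Y] {X r : Y → Vec d} (hX : Measurable X) (hr : Measurable r) :
    Measurable fun y => p.npcDirection ς (X y) (r y) := by
  classical
  have h1 : Measurable (signWith ς) := by
    have : signWith ς = fun a => if a = 0 then ς else if 0 < a then 1 else -1 := by
      ext a
      rw [signWith]
    rw [this]
    exact Measurable.ite (measurableSet_singleton 0) measurable_const
      (Measurable.ite measurableSet_Ioi measurable_const measurable_const)
  exact ((h1.comp ((h.continuous_gradient.measurable.comp hX).inner hr)).neg.mul
    hr.norm.inv).smul hr

/-- The next iterate depends measurably on the current iterate and the random vector. -/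
theorem measurable_step_getD (h : p.Valid E Lg LH σ θ ω fstar) (ς : ℝ) :
    Measurable fun y : Vec d × Vec d => (p.step ς y.2 y.1).getD y.1 := by
  have hX : Measurable fun y : Vec d × Vec d => y.1 := measurable_fst
  have hU : Measurable fun y : Vec d × Vec d => y.2 := measurable_snd
  have hgX : Measurable fun y : Vec d × Vec d => gradient p.f y.1 :=
    h.continuous_gradient.measurable.comp hX
  have hA : ∀ v, Measurable fun y : Vec d × Vec d => p.Hbar y.1 v :=
    fun v => (h.measurable_Hbar v).comp hX
  have hA' : ∀ v, Measurable fun y : Vec d × Vec d => p.shiftedHbar y.1 v :=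
    fun v => (h.measurable_shiftedHbar v).comp hX
  have hlarge : MeasurableSet {y : Vec d × Vec d | p.εg < ‖gradient p.f y.1‖} :=
    measurableSet_lt measurable_const hgX.norm
  -- The three families are SOL, NPC at a large gradient and NPC at a small gradient, indexed by the
  -- stopping iteration. In all other cases the point stays put.
  refine measurable_of_countable_cover (ι := ℕ ⊕ ℕ ⊕ ℕ) (F₀ := fun y => y.1)
    (B := Sum.elim
      (fun j => {y | p.εg < ‖gradient p.f y.1‖} ∩
        {y | MinresStopSol (p.Hbar y.1) (gradient p.f y.1) p.η j})
      (Sum.elim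
        (fun j => {y | p.εg < ‖gradient p.f y.1‖} ∩
          {y | MinresStopNpc (p.Hbar y.1) (gradient p.f y.1) p.η j})
        (fun j => {y | p.εg < ‖gradient p.f y.1‖}ᶜ ∩
          {y | MinresStopNpc (p.shiftedHbar y.1) y.2 0 j})))
    (G := Sum.elim
      (fun j y => y.1 + greatest (p.armijo p.ρS y.1
        (minresState (p.Hbar y.1) (gradient p.f y.1) j).s ∩ Set.Iic 1) •
          (minresState (p.Hbar y.1) (gradient p.f y.1) j).s)
      (Sum.elim
        (fun j y => y.1 + greatest (p.armijo p.ρN y.1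
          (minresState (p.Hbar y.1) (gradient p.f y.1) j).r) •
            (minresState (p.Hbar y.1) (gradient p.f y.1) j).r)
        (fun j y => y.1 + greatest (p.curvatureArmijo y.1
          (p.npcDirection ς y.1 (minresState (p.shiftedHbar y.1) y.2 j).r)) •
            p.npcDirection ς y.1 (minresState (p.shiftedHbar y.1) y.2 j).r)))
    ?_ ?_ hX ?_ ?_
  · rintro (j | j | j)
    · exact hlarge.inter (measurableSet_stopSol hA hgX _ j)
    · exact hlarge.inter (measurableSet_stopNpc hA hgX _ j)
    · exact hlarge.compl.inter (measurableSet_stopNpc hA' hU _ j)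
  · rintro (j | j | j)
    · exact h.measurable_armijo_Iic_point _ hX (measurableState_minresState hA hgX j).s
    · exact h.measurable_armijo_point _ hX (measurableState_minresState hA hgX j).r
    · exact h.measurable_curvatureArmijo_point hX
        (h.measurable_npcDirection ς hX (measurableState_minresState hA' hU j).r)
  · rintro (j | j | j) y ⟨hy1, hy2⟩
    · have hy1 : p.εg < ‖gradient p.f y.1‖ := hy1
      rw [step, if_pos hy1, minres_eq_of_stopSol hy2]
      exact lineSearchStep_getD _ _ _
    · have hy1 : p.εg < ‖gradient p.f y.1‖ := hy1
      rw [step, if_pos hy1, minres_eq_of_stopNpc hy2]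
      exact lineSearchStep_getD _ _ _
    · have hy1 : ¬ p.εg < ‖gradient p.f y.1‖ := hy1
      have hm := minres_eq_of_stopNpc hy2
      rw [shiftedHbar] at hm
      rw [step, if_neg hy1, hm]
      exact lineSearchStep_getD _ _ _
  · intro y hy
    by_cases hy1 : p.εg < ‖gradient p.f y.1‖
    · have hm : minres (p.Hbar y.1) (gradient p.f y.1) p.η = none :=
        minres_eq_none (fun j hj => hy (Sum.inl j) ⟨hy1, hj⟩)
          fun j hj => hy (Sum.inr (Sum.inl j)) ⟨hy1, hj⟩
      rw [step, if_pos hy1, hm]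
      rfl
    · by_cases hex : ∃ j, MinresStopSol (p.shiftedHbar y.1) y.2 0 j
      · obtain ⟨j, hj⟩ := hex
        have hm := minres_eq_of_stopSol hj
        rw [shiftedHbar] at hm
        rw [step, if_neg hy1, hm]
        rfl
      · push Not at hex
        have hm := minres_eq_none hex fun j hj => hy (Sum.inr (Sum.inr j)) ⟨hy1, hj⟩
        rw [shiftedHbar] at hm
        rw [step, if_neg hy1, hm]
        rfl

lemma measurable_run (h : p.Valid E Lg LH σ θ ω fstar) (x₀ : Vec d) (ς : ℕ → ℝ) {Y : Type*}
    [MeasurableSpace Y] {U : Y → ℕ → Vec d} (hU : ∀ k, Measurable fun y => U y k) (k : ℕ) :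
    Measurable fun y => p.run x₀ ς (U y) k := by
  induction k with
  | zero => exact measurable_const
  | succ k ih =>
    have h1 := (h.measurable_step_getD (ς k)).comp (ih.prodMk (hU k))
    simp only [Problem.run]
    exact h1

end Problem.Valid

end Run

/-! ### Random vectors almost surely detect negative curvature -/

section NegativeCurvature

variable {d : ℕ}

lemma exists_negative_eigenvector {A : Vec d →L[ℝ] Vec d}
    (hA : ∀ x y, inner ℝ (A x) y = inner ℝ x (A y)) {v : Vec d} (hv : inner ℝ v (A v) < 0) :
    ∃ e : Vec d, e ≠ 0 ∧ ∃ μ : ℝ, μ < 0 ∧ A e = μ • e := by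
  by_contra hcon
  push Not at hcon
  have hsymm : (A : Vec d →ₗ[ℝ] Vec d).IsSymmetric := fun x y => hA x y
  have hn : Module.finrank ℝ (Vec d) = d := finrank_euclideanSpace_fin
  set b := hsymm.eigenvectorBasis hn
  have hb : ∀ i, A (b i) = hsymm.eigenvalues hn i • b i := fun i =>
    hsymm.apply_eigenvectorBasis hn i
  have hnonneg : ∀ i, 0 ≤ hsymm.eigenvalues hn i := fun i => by
    by_contra hneg
    exact hcon (b i) (b.orthonormal.ne_zero i) _ (not_le.1 hneg) (hb i)
  rw [← b.sum_inner_mul_inner v (A v)] at hv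
  refine absurd hv (not_lt.2 (Finset.sum_nonneg fun i _ => ?_))
  rw [← hA, hb, real_inner_smul_left, real_inner_comm v (b i)]
  have := mul_nonneg (hnonneg i) (mul_self_nonneg (inner ℝ v (b i)))
  nlinarith

/-- The surface measure of a set is a multiple of the volume of the cone over it, and here the cone
lies in a proper subspace. -/
lemma uniformSphere_orthogonal {e : Vec d} (he : e ≠ 0) :
    uniformSphere d {u | inner ℝ e (u : Vec d) = 0} = 0 := by
  have hmeas : MeasurableSet {u : Metric.sphere (0 : Vec d) 1 | inner ℝ e (u : Vec d) = 0} :=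
    measurableSet_eq_fun (measurable_const.inner measurable_subtype_coe) measurable_const
  have h1 : (volume : Measure (Vec d)).toSphere {u | inner ℝ e (u : Vec d) = 0} = 0 := by
    rw [Measure.toSphere_apply' _ hmeas]
    refine mul_eq_zero_of_right _ (measure_mono_null (t := ((ℝ ∙ e)ᗮ : Submodule ℝ (Vec d))) ?_ ?_)
    · rintro z ⟨a, -, y, ⟨u, hu, rfl⟩, rfl⟩
      simp only [SetLike.mem_coe]
      exact Submodule.smul_mem _ _ (Submodule.mem_orthogonal_singleton_iff_inner_right.2 hu)
    · refine Measure.addHaar_submodule _ _ fun htop => he ?_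
      have h2 : e ∈ (ℝ ∙ e)ᗮ := by rw [htop]; trivial
      exact inner_self_eq_zero.1 (Submodule.mem_orthogonal_singleton_iff_inner_right.1 h2)
  rw [uniformSphere, Measure.smul_apply, h1, smul_zero]

variable {p : Problem d} {E : Vec d → Vec d →L[ℝ] Vec d} {Lg LH σ θ ω fstar : ℝ}

/-- The pairs of points and random vectors such that MINRES misses existing negative curvature. -/
def Problem.missed (p : Problem d) : Set (Vec d × Metric.sphere (0 : Vec d) 1) :=
  {y | (∃ j, MinresStopSol (p.shiftedHbar y.1) (y.2 : Vec d) 0 j) ∧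
    ∃ v, inner ℝ v (p.shiftedHbar y.1 v) < 0}

lemma Problem.Valid.measurableSet_missed (h : p.Valid E Lg LH σ θ ω fstar) :
    MeasurableSet p.missed := by
  have hX : Measurable fun y : Vec d × Metric.sphere (0 : Vec d) 1 => y.1 := measurable_fst
  have hU : Measurable fun y : Vec d × Metric.sphere (0 : Vec d) 1 => (y.2 : Vec d) :=
    measurable_subtype_coe.comp measurable_snd
  have hA : ∀ v, Measurable fun y : Vec d × Metric.sphere (0 : Vec d) 1 => p.shiftedHbar y.1 v :=
    fun v => (h.measurable_shiftedHbar v).comp hX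
  have h1 : MeasurableSet {y : Vec d × Metric.sphere (0 : Vec d) 1 |
      ∃ j, MinresStopSol (p.shiftedHbar y.1) (y.2 : Vec d) 0 j} := by
    simp only [Set.ofPred_exists]
    exact .iUnion fun j => measurableSet_stopSol hA hU 0 j
  -- Negativity is an open condition on v, so a dense sequence of test vectors suffices.
  have h2 : {y : Vec d × Metric.sphere (0 : Vec d) 1 | ∃ v, inner ℝ v (p.shiftedHbar y.1 v) < 0} =
      ⋃ n : ℕ, {y | inner ℝ (TopologicalSpace.denseSeq (Vec d) n)
        (p.shiftedHbar y.1 (TopologicalSpace.denseSeq (Vec d) n)) < 0} := by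
    ext y
    simp only [Set.mem_ofPred_eq, Set.mem_iUnion]
    constructor
    · rintro ⟨v, hv⟩
      have hopen : IsOpen {v | inner ℝ v (p.shiftedHbar y.1 v) < 0} :=
        isOpen_lt (by fun_prop) continuous_const
      obtain ⟨n, hn⟩ := (TopologicalSpace.denseRange_denseSeq (Vec d)).exists_mem_open hopen ⟨v, hv⟩
      exact ⟨n, hn⟩
    · rintro ⟨n, hn⟩
      exact ⟨_, hn⟩
  have h3 : MeasurableSet {y : Vec d × Metric.sphere (0 : Vec d) 1 |
      ∃ v, inner ℝ v (p.shiftedHbar y.1 v) < 0} := by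
    rw [h2]
    exact .iUnion fun n => measurableSet_lt (measurable_const.inner (hA _)) measurable_const
  exact h1.inter h3

/-- The eigenvector e depends on x alone, so all missing draws lie in one hyperplane. -/
lemma Problem.Valid.uniformSphere_missed (h : p.Valid E Lg LH σ θ ω fstar) (x : Vec d) :
    uniformSphere d (Prod.mk x ⁻¹' p.missed) = 0 := by
  by_cases hv : ∃ v, inner ℝ v (p.shiftedHbar x v) < 0
  · obtain ⟨v, hv⟩ := hv
    obtain ⟨e, he, μ, hμ, heμ⟩ := exists_negative_eigenvector (h.shiftedHbar_symm x) hv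
    refine measure_mono_null ?_ (uniformSphere_orthogonal he)
    rintro u ⟨⟨j, hj⟩, -⟩
    refine hj.inner_eigenvector (h.shiftedHbar_symm x) ?_ hμ heμ
    exact ne_zero_of_mem_unit_sphere u
  · convert measure_empty (μ := uniformSphere d)
    ext u
    simp only [Set.mem_preimage, Set.mem_empty_iff_false, iff_false]
    exact fun hu => hv hu.2

/-- Almost surely, MINRES never misses existing negative curvature along the run. -/
theorem Problem.Valid.ae_notMem_missed (h : p.Valid E Lg LH σ θ ω fstar) (x₀ : Vec d) (ς : ℕ → ℝ)
    {Ω : Type*} [MeasurableSpace Ω] (P : Measure Ω) [IsProbabilityMeasure P]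
    (u : ℕ → Ω → Metric.sphere (0 : Vec d) 1) (hu_meas : ∀ k, Measurable (u k))
    (hu_unif : ∀ k, Measure.map (u k) P = uniformSphere d) (hu_indep : iIndepFun u P) :
    ∀ᵐ w ∂P, ∀ k, (p.run x₀ ς (fun i => (u i w : Vec d)) k, u k w) ∉ p.missed := by
  rw [ae_all_iff]
  intro k
  set X : Ω → Vec d := fun w => p.run x₀ ς (fun i => (u i w : Vec d)) k with hX
  have hXm : Measurable X :=
    h.measurable_run x₀ ς (fun i => measurable_subtype_coe.comp (hu_meas i)) k
  have hindep : IndepFun X (u k) P := by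
    have h1 := hu_indep.indepFun_finset (Finset.range k) {k} (by simp) hu_meas
    -- The filler 0 for later draws never reaches x_k, by `run_congr`.
    let ext : (Finset.range k → Metric.sphere (0 : Vec d) 1) → ℕ → Vec d := fun τ i =>
      if hi : i ∈ Finset.range k then (τ ⟨i, hi⟩ : Vec d) else 0
    have hext : ∀ i, Measurable fun τ => ext τ i := fun i => by
      by_cases hi : i ∈ Finset.range k
      · simp only [ext, dif_pos hi]
        exact measurable_subtype_coe.comp (measurable_pi_apply _)
      · simp only [ext, dif_neg hi]
        exact measurable_const
    have h2 := h1.comp (h.measurable_run x₀ ς hext k)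
      (measurable_pi_apply (⟨k, Finset.mem_singleton_self k⟩ : ({k} : Finset ℕ)))
    have h3 : X = (fun τ => p.run x₀ ς (ext τ) k) ∘
        fun w (i : Finset.range k) => u i w := by
      ext1 w
      refine Problem.run_congr fun i hi => ?_
      simp only [ext, dif_pos (Finset.mem_range.2 hi)]
    rw [h3]
    exact h2
  have hmap := (indepFun_iff_map_prod_eq_prod_map_map hXm.aemeasurable
    (hu_meas k).aemeasurable).1 hindep
  have hprob : IsProbabilityMeasure (Measure.map (u k) P) :=
    Measure.isProbabilityMeasure_map (hu_meas k).aemeasurable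
  have hnull : Measure.map (fun w => (X w, u k w)) P p.missed = 0 := by
    rw [hmap]
    refine (Measure.measure_prod_null h.measurableSet_missed).2 (.of_forall fun x => ?_)
    rw [hu_unif]
    exact h.uniformSphere_missed x
  rw [Measure.map_apply (hXm.prodMk (hu_meas k)) h.measurableSet_missed] at hnull
  exact measure_eq_zero_iff_ae_notMem.1 hnull

end NegativeCurvature

/-! ### Counting the iterations -/

section Complexity

variable {d : ℕ} {p : Problem d} {E : Vec d → Vec d →L[ℝ] Vec d} {Lg LH σ θ ω fstar : ℝ}

/-- As long as the algorithm does not terminate, every step decreases `f` by half of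
`p.decrease σ θ ω Lg LH` on average, up to one step that leads to a small gradient. -/
lemma Problem.Valid.iterate_decrease (h : p.Valid E Lg LH σ θ ω fstar) {x₀ : Vec d} {ς : ℕ → ℝ}
    (hς : ∀ k, ς k = 1 ∨ ς k = -1) {U : ℕ → Vec d} (hU : ∀ k, U k ≠ 0)
    (hnpc : ∀ (k : ℕ) (x r : Vec d), p.iterate x₀ ς U k = some x → p.εg < ‖gradient p.f x‖ →
      minres (p.Hbar x) (gradient p.f x) p.η = some (r, DirType.NPC) →
      ω * ‖gradient p.f x‖ ≤ ‖r‖) {M : ℕ}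
    (hM : ∀ k ≤ M, ∀ x, p.iterate x₀ ς U k = some x → ‖gradient p.f x‖ ≤ p.εg →
      ¬ (p.step (ς k) (U k) x = Outcome.terminated ∧
        ∃ j, MinresStopSol (p.shiftedHbar x) (U k) 0 j)) :
    ∀ k ≤ M + 1, ∃ x, p.iterate x₀ ς U k = some x ∧
      (k * (p.decrease σ θ ω Lg LH / 2) ≤ p.f x₀ - p.f x ∨
        (‖gradient p.f x‖ ≤ p.εg ∧
          k * (p.decrease σ θ ω Lg LH / 2) ≤
            p.f x₀ - p.f x + p.decrease σ θ ω Lg LH / 2)) := by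
  set D := p.decrease σ θ ω Lg LH with hD
  have hDpos : 0 < D := h.decrease_pos
  intro k
  induction k with
  | zero => exact fun _ => ⟨x₀, rfl, Or.inl (by simp)⟩
  | succ k ih =>
    intro hk
    obtain ⟨x, hx, hdec⟩ := ih (by omega)
    have hsucc : ∀ {y}, p.step (ς k) (U k) x = Outcome.moved y →
        p.iterate x₀ ς U (k + 1) = some y := fun {y} hy => by
      simp only [Problem.iterate, hx, hy]
    push_cast
    by_cases hg : p.εg < ‖gradient p.f x‖
    · have hdec' := hdec.resolve_right fun hc => absurd hc.1 (not_le.2 hg)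
      obtain ⟨y, hy, hle, hy'⟩ := h.step_of_lt (ς k) (U k) x hg fun r hr => hnpc k x r hx hg hr
      refine ⟨y, hsucc hy, ?_⟩
      rcases hy' with hy' | hy'
      -- The step takes a credit of D/2, available only at a small gradient.
      · exact Or.inr ⟨hy', by linarith⟩
      · exact Or.inl (by linarith)
    · have hg := not_lt.1 hg
      have hdec' : k * (D / 2) ≤ p.f x₀ - p.f x + D / 2 := by
        rcases hdec with hdec | hdec
        · linarith
        · exact hdec.2
      rcases h.step_of_le (hς k) (hU k) hg with ⟨y, hy, hy'⟩ | hterm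
      -- The gain D covers this step and repays a possible credit.
      · exact ⟨y, hsucc hy, Or.inl (by linarith)⟩
      · exact absurd hterm (hM k (by omega) x hx hg)

/-- The algorithm terminates within the claimed number of iterations. -/
theorem Problem.Valid.exists_terminated (h : p.Valid E Lg LH σ θ ω fstar) {x₀ : Vec d} {ς : ℕ → ℝ}
    (hς : ∀ k, ς k = 1 ∨ ς k = -1) {U : ℕ → Vec d} (hU : ∀ k, U k ≠ 0)
    (hnpc : ∀ (k : ℕ) (x r : Vec d), p.iterate x₀ ς U k = some x → p.εg < ‖gradient p.f x‖ →
      minres (p.Hbar x) (gradient p.f x) p.η = some (r, DirType.NPC) →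
      ω * ‖gradient p.f x‖ ≤ ‖r‖) :
    ∃ k ≤ ⌈2 * (p.f x₀ - fstar) / cMin σ p.ρS p.ρN θ ω Lg LH *
        max (p.εg ^ (-(3 / 2) : ℝ)) (p.εH ^ (-3 : ℝ)) + 1⌉₊,
      ∃ x, p.iterate x₀ ς U k = some x ∧ ‖gradient p.f x‖ ≤ p.εg ∧
        p.step (ς k) (U k) x = Outcome.terminated ∧
        ∃ j, MinresStopSol (p.shiftedHbar x) (U k) 0 j := by
  set X := 2 * (p.f x₀ - fstar) / cMin σ p.ρS p.ρN θ ω Lg LH *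
        max (p.εg ^ (-(3 / 2) : ℝ)) (p.εH ^ (-3 : ℝ)) + 1 with hX
  by_contra hcon
  push Not at hcon
  obtain ⟨x, -, hx⟩ := h.iterate_decrease hς hU hnpc (M := ⌈X⌉₊)
    (fun k hk x hx hg hterm => by
      obtain ⟨hterm, j, hj⟩ := hterm
      exact hcon k hk x hx hg hterm j hj) (⌈X⌉₊ + 1) le_rfl
  set D := p.decrease σ θ ω Lg LH with hD
  have hDpos : 0 < D := h.decrease_pos
  have hmin := h.fstar_le x
  have h1 : ((⌈X⌉₊ + 1 : ℕ) : ℝ) * (D / 2) ≤ p.f x₀ - fstar + D / 2 := by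
    rcases hx with hx | hx
    · linarith
    · linarith [hx.2]
  push_cast at h1
  -- The summand 1 in the bound is the outstanding credit; ⌈X⌉₊ + 1 steps would need more than f can
  -- lose.
  have h2 : X * (D / 2) = p.f x₀ - fstar + D / 2 := by
    have h3 := h.cMin_pos
    have h4 := h.max_pos
    rw [hX, hD, Problem.decrease]
    field_simp
  have h5 : X * (D / 2) ≤ ⌈X⌉₊ * (D / 2) := by
    have := Nat.le_ceil X
    gcongr
  linarith

end Complexity

end NewtonMR

/-! ### The almost sure complexity bound -/

theorem mainTheorem4 {d : ℕ} (hd : 1 ≤ d)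
    -- the objective, its smoothness, its minimum
    (f : NewtonMR.Vec d → ℝ) (hf : ContDiff ℝ 2 f)
    (Lg : ℝ) (hLg : ∀ x, ‖NewtonMR.hessian f x‖ ≤ Lg)
    (LH : ℝ) (hLH_pos : 0 < LH)
    (hLH : ∀ x y, ‖NewtonMR.hessian f x - NewtonMR.hessian f y‖ ≤ LH * ‖x - y‖)
    (fstar : ℝ) (hfstar : IsLeast (Set.range f) fstar)
    -- the noise
    (E : NewtonMR.Vec d → NewtonMR.Vec d →L[ℝ] NewtonMR.Vec d)
    (hE_meas : ∀ v, Measurable fun x => E x v)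
    (hE_symm : ∀ x, IsSelfAdjoint (E x))
    (ε : ℝ) (hε_pos : 0 < ε) (hE : ∀ x, ‖E x‖ ≤ ε)
    -- the parameters
    (εg εH : ℝ) (hεg : 0 < εg) (hεg1 : εg ≤ 1) (hεH : 0 < εH) (hεH1 : εH ≤ 1)
    (ρS ρN : ℝ) (hρS : 0 < ρS) (hρS1 : ρS < 1 / 2) (hρN : 0 < ρN) (hρN1 : ρN < 1)
    (θ η : ℝ) (hθ : 0 < θ) (hη : η = θ * Real.sqrt εg)
    -- Krylov subspace regularity
    (σ : ℝ) (hσ : 0 < σ)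
    (hkrylov : NewtonMR.KrylovRegular f (fun x => NewtonMR.hessian f x + E x) η σ)
    -- the bounds on the noise
    (hε1 : ε ≤ Real.sqrt εg / (η + σ)) (hε2 : ε ≤ σ * (1 - 2 * ρS) / 2) (hε3 : ε ≤ 1 - ρN)
    (hε4 : ε ≤ εH / 10) (hε5 : ε ≤ (1 - ρN) * εH / (2 * (3 - ρN)))
    -- the algorithm
    (p : NewtonMR.Problem d)
    (hp : p = { f := f, Hbar := fun x => NewtonMR.hessian f x + E x, εg := εg, εH := εH,
                ε := ε, η := η, ρS := ρS, ρN := ρN })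
    (x₀ : NewtonMR.Vec d) (ς : ℕ → ℝ) (hς : ∀ k, ς k = 1 ∨ ς k = -1)
    -- independent random vectors, uniformly distributed on the unit sphere
    {Ω : Type*} [MeasurableSpace Ω] (P : MeasureTheory.Measure Ω)
    [MeasureTheory.IsProbabilityMeasure P]
    (u : ℕ → Ω → Metric.sphere (0 : NewtonMR.Vec d) 1)
    (hu_meas : ∀ k, Measurable (u k))
    (hu_unif : ∀ k, MeasureTheory.Measure.map (u k) P = NewtonMR.uniformSphere d)
    (hu_indep : ProbabilityTheory.iIndepFun u P)
    -- the regularity of the directions of nonpositive curvature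
    (ω : ℝ) (hω : 0 < ω)
    (hnpc : ∀ᵐ w ∂P, ∀ (k : ℕ) (x r : NewtonMR.Vec d),
      p.iterate x₀ ς (fun i => (u i w : NewtonMR.Vec d)) k = some x →
      εg < ‖gradient f x‖ →
      NewtonMR.minres (p.Hbar x) (gradient f x) η = some (r, NewtonMR.DirType.NPC) →
      ω * ‖gradient f x‖ ≤ ‖r‖) :
    ∀ᵐ w ∂P, ∃ (k : ℕ) (x : NewtonMR.Vec d),
      k ≤ ⌈2 * (f x₀ - fstar) /
            min (min (2 * NewtonMR.c₁ σ ρS LH) (2 * NewtonMR.c₂ σ ρS θ Lg LH))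
              (min (2 * NewtonMR.c₃ σ ρN ω LH) (NewtonMR.c₄ ρN LH)) *
            max (εg ^ (-(3 / 2) : ℝ)) (εH ^ (-3 : ℝ)) + 1⌉₊ ∧
      p.iterate x₀ ς (fun i => (u i w : NewtonMR.Vec d)) k = some x ∧
      p.step (ς k) (u k w : NewtonMR.Vec d) x = NewtonMR.Outcome.terminated ∧
      NewtonMR.IsSecondOrderOptimal f εg εH x := by
  have hvalid : p.Valid E Lg LH σ θ ω fstar := by
    subst hp
    exact
      { contDiff := hf
        hessian_le := hLg
        LH_pos := hLH_pos
        lipschitz := hLH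
        fstar_le := fun x => hfstar.2 ⟨x, rfl⟩
        Hbar_eq := fun _ => rfl
        E_meas := hE_meas
        E_symm := hE_symm
        ε_pos := hε_pos
        E_le := hE
        εg_pos := hεg
        εg_le := hεg1
        εH_pos := hεH
        ρS_pos := hρS
        ρS_lt := hρS1
        ρN_pos := hρN
        ρN_lt := hρN1
        θ_pos := hθ
        η_eq := hη
        σ_pos := hσ
        krylovRegular := hkrylov
        ε_le₁ := hε1
        ε_le₂ := hε2
        ε_le₄ := hε4
        ε_le₅ := hε5
        ω_pos := hω }
  filter_upwards [hnpc, hvalid.ae_notMem_missed x₀ ς P u hu_meas hu_unif hu_indep] with w hw hmiss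
  have hpf : p.f = f := by rw [hp]
  have hpεg : p.εg = εg := by rw [hp]
  have hpεH : p.εH = εH := by rw [hp]
  have hpη : p.η = η := by rw [hp]
  have hpρS : p.ρS = ρS := by rw [hp]
  have hpρN : p.ρN = ρN := by rw [hp]
  obtain ⟨k, hk, x, hx, hg, hterm, hres⟩ := hvalid.exists_terminated (x₀ := x₀) hς
    (U := fun i => (u i w : NewtonMR.Vec d)) (fun i => ne_zero_of_mem_unit_sphere (u i w))
    (by rw [hpf, hpεg, hpη]; exact hw)
  refine ⟨k, x, ?_, hx, hterm, ?_⟩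
  · rw [hpf, hpεg, hpεH, hpρS, hpρN] at hk
    exact hk
  -- Outside the null event a SOL answer certifies that the shifted Hessian has no negative
  -- curvature at all, not only on the Krylov space.
  · have hpsd : ∀ v, 0 ≤ inner ℝ v (p.shiftedHbar x v) := fun v => by
      by_contra hneg
      have h1 := hmiss k
      rw [NewtonMR.Problem.run_eq_of_iterate hx] at h1
      exact h1 ⟨hres, v, not_le.1 hneg⟩
    have h2 := hvalid.isSecondOrderOptimal hg hpsd
    rwa [hpf, hpεg, hpεH] at h2
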